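/- For $L>0$ let $R_L=(0,L)\times(0,1/L)\subset\mathbb{R}^2$, and let $\Delta_L$ be the (positive) Dirichlet Laplacian on $L^2(R_L)$, i.e. the Friedrichs extension of $-(\partial_1^2+\partial_2^2)$ on $C_c^\infty(R_L)$. Let $\zeta_L(s)=\sum_k\lambda_k^{-s}$, $\operatorname{Re}s>1$, be its spectral zeta function, where $\lambda_1\le\lambda_2\le\dots$ are the positive eigenvalues of $\Delta_L$ repeated according to their (finite) multiplicity. Then for every $L>0$ the series converges for $\operatorname{Re}s>1$, $\zeta_L$ has a meromorphic continuation to $\mathbb{C}$ that is holomorphic at $s=0$, so that the zeta-regularized determinant $\det\Delta_L:=e^{-\zeta_L'(0)}$ is well defined, it is a real number, and $$\det\Delta_L=\left(\frac{|\eta(i/L^2)|^{2}}{2L}\right)^{1/2}=\frac{|\eta(i/L^2)|}{\sqrt{2L}},$$ where $\eta(z)=e^{\pi i z/12}\prod_{n\ge1}(1-e^{2\pi i n z})$ is the Dedekind eta function. Moreover, $\det\Delta_L$ is uniquely maximized at $L=1$, i.e. $\det\Delta_L<\det\Delta_1$ for all $L>0$ with $L\ne1$, and $\det\Delta_L\to0$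 as $L\to0^+$ and as $L\to\infty$. -/

import Mathlib

open MeasureTheory TopologicalSpace
open scoped Distributions Gradient

noncomputable section

namespace DirichletDet

/-- The Euclidean plane. -/
abbrev Plane : Type := EuclideanSpace ℝ (Fin 2)

/-- The real Hilbert space `L²(Ω)` for Lebesgue measure on `Ω`. -/
abbrev L2 (Ω : Opens Plane) : Type :=
  Lp ℝ 2 ((volume : Measure Plane).restrict (Ω : Set Plane))

/-- The real Hilbert space `L²(Ω; ℝ²)` of square integrable vector fields on `Ω`. -/
abbrev L2Vec (Ω : Opens Plane) : Type :=
  Lp Plane 2 ((volume : Measure Plane).restrict (Ω : Set Plane))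

lemma testFunction_differentiable {Ω : Opens Plane} (φ : 𝓓(Ω, ℝ)) :
    Differentiable ℝ (φ : Plane → ℝ) :=
  φ.contDiff.differentiable (by simp)

/-- The pairs `(φ, ∇φ)`, as classes in `L²(Ω) × L²(Ω; ℝ²)`, for smooth functions `φ` with compact
support in `Ω`. -/
def testGradientGraph (Ω : Opens Plane) : Submodule ℝ (L2 Ω × L2Vec Ω) where
  carrier := {p | ∃ φ : 𝓓(Ω, ℝ),
    (p.1 : Plane → ℝ) =ᵐ[volume.restrict (Ω : Set Plane)] (φ : Plane → ℝ) ∧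
    (p.2 : Plane → Plane) =ᵐ[volume.restrict (Ω : Set Plane)] ∇ (φ : Plane → ℝ)}
  zero_mem' := by
    refine ⟨0, ?_, ?_⟩
    · filter_upwards [Lp.coeFn_zero ℝ 2 (volume.restrict (Ω : Set Plane))] with x hx
      simpa using hx
    · filter_upwards [Lp.coeFn_zero Plane 2 (volume.restrict (Ω : Set Plane))] with x hx
      have h0 : ((0 : 𝓓(Ω, ℝ)) : Plane → ℝ) = fun _ => 0 := by ext; simp
      rw [h0, gradient_fun_const]
      simpa using hx
  add_mem' := by
    rintro p q ⟨φ, h1, h2⟩ ⟨ψ, h3, h4⟩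
    refine ⟨φ + ψ, ?_, ?_⟩
    · filter_upwards [h1, h3, Lp.coeFn_add p.1 q.1] with x a b c
      simp only [Prod.fst_add, c, Pi.add_apply, a, b, FunLike.coe_add]
    · filter_upwards [h2, h4, Lp.coeFn_add p.2 q.2] with x a b c
      have h : ((φ + ψ : 𝓓(Ω, ℝ)) : Plane → ℝ) = (φ : Plane → ℝ) + (ψ : Plane → ℝ) := by
        ext; simp
      rw [Prod.snd_add, c, Pi.add_apply, a, b, h, gradient, gradient, gradient,
        fderiv_add (testFunction_differentiable φ x) (testFunction_differentiable ψ x), map_add]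
  smul_mem' := by
    rintro c p ⟨φ, h1, h2⟩
    refine ⟨c • φ, ?_, ?_⟩
    · filter_upwards [h1, Lp.coeFn_smul c p.1] with x a b
      simp only [Prod.smul_fst, b, Pi.smul_apply, a, FunLike.coe_smul]
    · filter_upwards [h2, Lp.coeFn_smul c p.2] with x a b
      have h : ((c • φ : 𝓓(Ω, ℝ)) : Plane → ℝ) = c • (φ : Plane → ℝ) := by
        ext; simp
      rw [Prod.smul_snd, b, Pi.smul_apply, a, h, gradient, gradient,
        fderiv_const_smul (testFunction_differentiable φ x) c]
      simp

/-- The Sobolev space `H¹₀(Ω)`, each element `u` being recorded together with its weak gradient: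
the closure of the pairs `(φ, ∇φ)` in `L²(Ω) × L²(Ω; ℝ²)`. -/
def sobolevH10 (Ω : Opens Plane) : Submodule ℝ (L2 Ω × L2Vec Ω) :=
  (testGradientGraph Ω).topologicalClosure

/-- The graph of the (positive) Dirichlet Laplacian on `Ω`, the Friedrichs extension of
`-(∂₁² + ∂₂²)` on smooth functions with compact support in `Ω`: the pairs `(u, f)` with
`u ∈ H¹₀(Ω)`, `f ∈ L²(Ω)` and `∫ ∇u · ∇v = ∫ f v` for all `v ∈ H¹₀(Ω)`. -/
def dirichletLaplacian (Ω : Opens Plane) : Submodule ℝ (L2 Ω × L2 Ω) where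
  carrier := {p | ∃ G : L2Vec Ω, (p.1, G) ∈ sobolevH10 Ω ∧
    ∀ w ∈ sobolevH10 Ω, inner ℝ G w.2 = inner ℝ p.2 w.1}
  zero_mem' := ⟨0, (sobolevH10 Ω).zero_mem, by simp⟩
  add_mem' := by
    rintro p q ⟨G, hG, h⟩ ⟨K, hK, k⟩
    refine ⟨G + K, (sobolevH10 Ω).add_mem hG hK, fun w hw => ?_⟩
    rw [inner_add_left, h w hw, k w hw, Prod.snd_add, inner_add_left]
  smul_mem' := by
    rintro c p ⟨G, hG, h⟩
    refine ⟨c • G, (sobolevH10 Ω).smul_mem c hG, fun w hw => ?_⟩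
    rw [real_inner_smul_left, h w hw, Prod.smul_snd, real_inner_smul_left]

/-- The solutions `u` of `Δ u = μ u` for the Dirichlet Laplacian `Δ` on `Ω`. -/
def eigenspace (Ω : Opens Plane) (μ : ℝ) : Submodule ℝ (L2 Ω) :=
  (dirichletLaplacian Ω).comap (LinearMap.prod LinearMap.id (μ • LinearMap.id))

/-- The set of positive eigenvalues of the Dirichlet Laplacian on `Ω`, without multiplicity. -/
def positiveEigenvalues (Ω : Opens Plane) : Set ℝ :=
  {μ | 0 < μ ∧ eigenspace Ω μ ≠ ⊥}

/-- `Z` is the spectral zeta function of the Dirichlet Laplacian on the planar domain `Ω`, continued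
to a neighbourhood of `0`: all eigenvalues have finite multiplicity; the sum of `μ ^ (-s)` over the
positive eigenvalues, with multiplicity, converges to `Z s` for `Re s > 1`; `Z` is meromorphic
on `ℂ` and holomorphic at `0`. -/
structure IsSpectralZeta (Ω : Opens Plane) (Z : ℂ → ℂ) : Prop where
  finite_mult : ∀ μ ∈ positiveEigenvalues Ω, FiniteDimensional ℝ (eigenspace Ω μ)
  hasSum : ∀ s : ℂ, 1 < s.re →
    HasSum (fun μ : positiveEigenvalues Ω =>
      (Module.finrank ℝ (eigenspace Ω (μ : ℝ)) : ℂ) * ((μ : ℝ) : ℂ) ^ (-s)) (Z s)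
  meromorphic : MeromorphicOn Z Set.univ
  analyticAt_zero : AnalyticAt ℂ Z 0

/-- `d` is the zeta-regularized determinant `exp (-ζ'(0))` of the Dirichlet Laplacian on `Ω`. -/
def IsZetaDeterminant (Ω : Opens Plane) (d : ℝ) : Prop :=
  ∃ Z : ℂ → ℂ, IsSpectralZeta Ω Z ∧ (d : ℂ) = Complex.exp (-deriv Z 0)

open Classical in
/-- The zeta-regularized determinant of the Dirichlet Laplacian on `Ω` (`0` if there is none). -/
def zetaDet (Ω : Opens Plane) : ℝ :=
  if h : ∃ d, IsZetaDeterminant Ω d then h.choose else 0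

/-- The open rectangle `(0, L) × (0, 1/L)`. -/
def rectangle (L : ℝ) : Opens Plane where
  carrier := {x | 0 < x 0 ∧ x 0 < L ∧ 0 < x 1 ∧ x 1 < L⁻¹}
  is_open' := by
    have c (i : Fin 2) : Continuous fun x : Plane => x i := by fun_prop
    exact (isOpen_lt continuous_const (c 0)).inter ((isOpen_lt (c 0) continuous_const).inter
      ((isOpen_lt continuous_const (c 1)).inter (isOpen_lt (c 1) continuous_const)))

end DirichletDet

end

/-!
The products `sin (π m x / L) sin (π n L y)` lie in `H¹₀`, since a smooth function vanishing on the
boundary is a limit of its truncations, and they form an orthonormal basis by Stone–Weierstrass, so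
the eigenvalues are `π (π r m² + π r⁻¹ n²)` with `r = L⁻²` and `m, n ≥ 1`. Their heat trace is a
product of two theta tails. Applying Jacobi's inversion formula to one of them splits off two
Riemann zeta functions; what remains decays rapidly at `0` and at `∞`, so its Mellin transform is
entire. As `1 / Γ(s) = s + O(s²)`, the derivative of the zeta function at `0` is the value there of
this Mellin transform plus special values of the Riemann zeta function. The former is a sum of
Bessel integrals of order `1 / 2`, which are elementary and sum to the logarithm of the product
defining `η`.

The logarithm of the determinant is thus, up to a constant, a strictly concave function of `r`. The
symmetry of the two sides makes it invariant under `r ↦ r⁻¹`, and since `1` lies strictly between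
`r` and `r⁻¹`, it has its strict maximum at `r = 1`.
-/

noncomputable section

namespace DirichletDet

open Asymptotics Filter Set Topology
open scoped Real ContDiff RealInnerProductSpace Laplacian

/-! ### A Bessel integral -/

lemma integrableOn_and_integral_Ioi_of_hasDerivAt_of_nonneg {g g' : ℝ → ℝ} {a l m : ℝ}
    (hderiv : ∀ x ∈ Ioi a, HasDerivAt g (g' x) x) (hnonneg : ∀ x ∈ Ioi a, 0 ≤ g' x)
    (ha : Tendsto g (𝓝[>] a) (𝓝 m)) (htop : Tendsto g atTop (𝓝 l)) :
    IntegrableOn g' (Ioi a) ∧ ∫ x in Ioi a, g' x = l - m := by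
  have heq : ∀ x ∈ Ioi a, Function.update g a m =ᶠ[𝓝 x] g := fun x hx => by
    filter_upwards [isOpen_ne.mem_nhds (ne_of_gt hx)] with y hy
    exact Function.update_of_ne hy _ _
  have hcont : ContinuousWithinAt (Function.update g a m) (Ici a) a := by
    rw [continuousWithinAt_update_same]
    simpa only [Ici_sdiff_left] using ha
  have hderiv' : ∀ x ∈ Ioi a, HasDerivAt (Function.update g a m) (g' x) x := fun x hx =>
    (hderiv x hx).congr_of_eventuallyEq (heq x hx)
  have htop' : Tendsto (Function.update g a m) atTop (𝓝 l) := by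
    refine htop.congr' ?_
    filter_upwards [eventually_gt_atTop a] with x hx using (heq x hx).eq_of_nhds.symm
  refine ⟨integrableOn_Ioi_deriv_of_nonneg hcont hderiv' hnonneg htop', ?_⟩
  rw [integral_Ioi_of_hasDerivAt_of_nonneg hcont hderiv' hnonneg htop', Function.update_self]

/-- The error function without its normalizing factor `2 / √π`. -/
def gaussPrimitive (x : ℝ) : ℝ := ∫ u in (0 : ℝ)..x, Real.exp (-u ^ 2)

lemma hasDerivAt_gaussPrimitive (x : ℝ) : HasDerivAt gaussPrimitive (Real.exp (-x ^ 2)) x :=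
  (show Continuous fun u : ℝ => Real.exp (-u ^ 2) by fun_prop).integral_hasStrictDerivAt 0 x
    |>.hasDerivAt

lemma gaussPrimitive_neg (x : ℝ) : gaussPrimitive (-x) = -gaussPrimitive x := by
  have h := intervalIntegral.integral_comp_neg (a := 0) (b := x) (fun u : ℝ => Real.exp (-u ^ 2))
  simp only [neg_sq, neg_zero] at h
  rw [gaussPrimitive, gaussPrimitive, intervalIntegral.integral_symm, h]

lemma tendsto_gaussPrimitive_atTop : Tendsto gaussPrimitive atTop (𝓝 (√π / 2)) := by
  have hi : IntegrableOn (fun u : ℝ => Real.exp (-u ^ 2)) (Ioi 0) := by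
    simpa using (integrable_exp_neg_mul_sq one_pos).integrableOn
  have h := intervalIntegral_tendsto_integral_Ioi 0 hi tendsto_id
  rwa [show ∫ u in Ioi (0 : ℝ), Real.exp (-u ^ 2) = √π / 2 by
    simpa using integral_gaussian_Ioi 1] at h

lemma tendsto_gaussPrimitive_atBot : Tendsto gaussPrimitive atBot (𝓝 (-(√π / 2))) :=
  (tendsto_gaussPrimitive_atTop.comp tendsto_neg_atBot_atTop).neg.congr fun x => by
    simp [gaussPrimitive_neg]

/-- The integrand `t ^ (-3/2) * exp (-a² t - b² / t)` of the integral representation of the Bessel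
function of order `1/2`. -/
def besselIntegrand (a b t : ℝ) : ℝ := t⁻¹ * (√t)⁻¹ * Real.exp (-(a ^ 2 * t) - b ^ 2 * t⁻¹)

/-- An antiderivative of `b * besselIntegrand a b` on the positive half-line. -/
def besselPrimitive (a b t : ℝ) : ℝ :=
  Real.exp (-(2 * a * b)) * gaussPrimitive (a * √t - b * (√t)⁻¹) -
    Real.exp (2 * a * b) * gaussPrimitive (a * √t + b * (√t)⁻¹)

lemma besselIntegrand_nonneg (a b : ℝ) {t : ℝ} (ht : 0 < t) : 0 ≤ besselIntegrand a b t := by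
  unfold besselIntegrand
  positivity

-- The squares `(a√t ∓ b/√t)²` only differ by the constant `∓ 2ab` from `a² t + b² / t`.
lemma hasDerivAt_besselPrimitive (a b : ℝ) {t : ℝ} (ht : 0 < t) :
    HasDerivAt (besselPrimitive a b) (b * besselIntegrand a b t) t := by
  have hs : 0 < √t := Real.sqrt_pos.2 ht
  have hst : √t ^ 2 = t := Real.sq_sqrt ht.le
  have hsi : √t * (√t)⁻¹ = 1 := mul_inv_cancel₀ hs.ne'
  have hi2 : (√t)⁻¹ ^ 2 = t⁻¹ := by rw [inv_pow, hst]
  have hd := Real.hasDerivAt_sqrt ht.ne'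
  have hdi := hd.inv hs.ne'
  have hminus := (hasDerivAt_gaussPrimitive _).comp t ((hd.const_mul a).sub (hdi.const_mul b))
  have hplus := (hasDerivAt_gaussPrimitive _).comp t ((hd.const_mul a).add (hdi.const_mul b))
  refine ((hminus.const_mul (Real.exp (-(2 * a * b)))).sub
    (hplus.const_mul (Real.exp (2 * a * b)))).congr_deriv ?_
  have eminus : Real.exp (-(2 * a * b)) * Real.exp (-(a * √t - b * (√t)⁻¹) ^ 2) =
      Real.exp (-(a ^ 2 * t) - b ^ 2 * t⁻¹) := by
    rw [← Real.exp_add]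
    congr 1
    linear_combination (2 * a * b) * hsi - a ^ 2 * hst - b ^ 2 * hi2
  have eplus : Real.exp (2 * a * b) * Real.exp (-(a * √t + b * (√t)⁻¹) ^ 2) =
      Real.exp (-(a ^ 2 * t) - b ^ 2 * t⁻¹) := by
    rw [← Real.exp_add]
    congr 1
    linear_combination -(2 * a * b) * hsi - a ^ 2 * hst - b ^ 2 * hi2
  change _ * (Real.exp (-(a * √t - b * (√t)⁻¹) ^ 2) * _) -
    _ * (Real.exp (-(a * √t + b * (√t)⁻¹) ^ 2) * _) = _
  rw [← mul_assoc, ← mul_assoc, eminus, eplus, ← mul_sub, hst, besselIntegrand]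
  field_simp
  ring

lemma tendsto_besselPrimitive_atTop {a : ℝ} (b : ℝ) (ha : 0 < a) :
    Tendsto (besselPrimitive a b) atTop
      (𝓝 (Real.exp (-(2 * a * b)) * (√π / 2) - Real.exp (2 * a * b) * (√π / 2))) := by
  have h1 : Tendsto (fun t : ℝ => a * √t) atTop atTop :=
    Real.tendsto_sqrt_atTop.const_mul_atTop ha
  have h2 : Tendsto (fun t : ℝ => b * (√t)⁻¹) atTop (𝓝 0) := by
    simpa using (tendsto_inv_atTop_zero.comp Real.tendsto_sqrt_atTop).const_mul b
  have hminus : Tendsto (fun t : ℝ => a * √t - b * (√t)⁻¹) atTop atTop := by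
    simpa [sub_eq_add_neg] using h1.atTop_add h2.neg
  exact ((tendsto_gaussPrimitive_atTop.comp hminus).const_mul _).sub
    ((tendsto_gaussPrimitive_atTop.comp (h1.atTop_add h2)).const_mul _)

lemma tendsto_besselPrimitive_zero (a : ℝ) {b : ℝ} (hb : 0 < b) :
    Tendsto (besselPrimitive a b) (𝓝[>] 0)
      (𝓝 (Real.exp (-(2 * a * b)) * -(√π / 2) - Real.exp (2 * a * b) * (√π / 2))) := by
  have h0 : Tendsto (fun t : ℝ => √t) (𝓝[>] 0) (𝓝[>] 0) := by
    refine tendsto_nhdsWithin_iff.2 ⟨?_, ?_⟩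
    · simpa using (Real.continuous_sqrt.tendsto 0).mono_left nhdsWithin_le_nhds
    · filter_upwards [self_mem_nhdsWithin] with t ht using Real.sqrt_pos.2 ht
  have h1 : Tendsto (fun t : ℝ => a * √t) (𝓝[>] 0) (𝓝 0) := by
    simpa using (h0.mono_right nhdsWithin_le_nhds).const_mul a
  have h2 : Tendsto (fun t : ℝ => b * (√t)⁻¹) (𝓝[>] 0) atTop :=
    (tendsto_inv_nhdsGT_zero.comp h0).const_mul_atTop hb
  have hminus : Tendsto (fun t : ℝ => a * √t - b * (√t)⁻¹) (𝓝[>] 0) atBot := by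
    simpa [sub_eq_add_neg] using h1.add_atBot (tendsto_neg_atTop_atBot.comp h2)
  exact ((tendsto_gaussPrimitive_atBot.comp hminus).const_mul _).sub
    ((tendsto_gaussPrimitive_atTop.comp (h1.add_atTop h2)).const_mul _)

lemma integrableOn_and_integral_mul_besselIntegrand {a b : ℝ} (ha : 0 < a) (hb : 0 < b) :
    IntegrableOn (fun t => b * besselIntegrand a b t) (Ioi 0) ∧
      ∫ t in Ioi (0 : ℝ), b * besselIntegrand a b t = √π * Real.exp (-(2 * a * b)) := by
  have h := integrableOn_and_integral_Ioi_of_hasDerivAt_of_nonneg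
    (fun t ht => hasDerivAt_besselPrimitive a b ht)
    (fun t ht => mul_nonneg hb.le (besselIntegrand_nonneg a b ht))
    (tendsto_besselPrimitive_zero a hb) (tendsto_besselPrimitive_atTop b ha)
  exact ⟨h.1, h.2.trans (by ring)⟩

lemma integrableOn_besselIntegrand {a b : ℝ} (ha : 0 < a) (hb : 0 < b) :
    IntegrableOn (besselIntegrand a b) (Ioi 0) :=
  (integrable_const_mul_iff (IsUnit.mk0 b hb.ne') _).1
    (integrableOn_and_integral_mul_besselIntegrand ha hb).1

lemma integral_besselIntegrand {a b : ℝ} (ha : 0 < a) (hb : 0 < b) :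
    ∫ t in Ioi (0 : ℝ), besselIntegrand a b t = √π / b * Real.exp (-(2 * a * b)) := by
  have h := (integrableOn_and_integral_mul_besselIntegrand ha hb).2
  rw [integral_const_mul] at h
  rw [div_mul_eq_mul_div, eq_div_iff hb.ne', mul_comm, h]

/-! ### Theta series -/

/-- The series `∑ exp (-π n² t)` over positive integers `n` (for `0 < t`), Riemann's `ψ`, expressed
through the theta kernel of the library. -/
def thetaTail (t : ℝ) : ℝ := (HurwitzZeta.evenKernel 0 t - 1) / 2

lemma hasSum_thetaTail {t : ℝ} (ht : 0 < t) :
    HasSum (fun n : ℕ => Real.exp (-(π * (n + 1) ^ 2 * t))) (thetaTail t) := by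
  have h := (HurwitzZeta.hasSum_nat_cosKernel₀ 0 ht).div_const 2
  rw [QuotientAddGroup.mk_zero, ← HurwitzZeta.evenKernel_eq_cosKernel_of_zero] at h
  exact h.congr_fun fun n => by simp

lemma continuousOn_thetaTail : ContinuousOn thetaTail (Ioi 0) :=
  ((HurwitzZeta.continuousOn_evenKernel 0).sub continuousOn_const).div_const 2

/-- The last term of the functional equation of `thetaTail`; it decays rapidly at `0`. -/
def dualThetaTail (t : ℝ) : ℝ := (√t)⁻¹ * thetaTail t⁻¹

lemma thetaTail_eq_dualThetaTail (t : ℝ) :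
    thetaTail t = (√t)⁻¹ / 2 - 1 / 2 + dualThetaTail t := by
  have h := HurwitzZeta.evenKernel_functional_equation 0 t
  rw [← HurwitzZeta.evenKernel_eq_cosKernel_of_zero, ← Real.sqrt_eq_rpow, one_div, one_div] at h
  rw [dualThetaTail, thetaTail, thetaTail, h]
  ring

lemma continuousOn_dualThetaTail : ContinuousOn dualThetaTail (Ioi 0) :=
  (Real.continuous_sqrt.continuousOn.inv₀ fun _ ht => (Real.sqrt_pos.2 ht).ne').mul
    (continuousOn_thetaTail.comp (continuousOn_inv₀.mono fun _ ht => ne_of_gt ht)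
      fun _ ht => inv_pos.2 (mem_Ioi.1 ht))

lemma thetaTail_isBigO_atTop (r : ℝ) : thetaTail =O[atTop] fun t => t ^ r := by
  obtain ⟨p, hp, h⟩ := HurwitzZeta.isBigO_atTop_evenKernel_sub 0
  simp only [if_true] at h
  exact ((h.trans (isLittleO_exp_neg_mul_rpow_atTop hp r).isBigO).const_mul_left 2⁻¹).congr_left
    fun t => by rw [thetaTail]; ring

lemma dualThetaTail_isBigO_zero (r : ℝ) : dualThetaTail =O[𝓝[>] 0] fun t => t ^ r := by
  have h := (isBigO_refl (fun t : ℝ => (√t)⁻¹) (𝓝[>] 0)).mul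
    ((thetaTail_isBigO_atTop (-(r + 1 / 2))).comp_tendsto tendsto_inv_nhdsGT_zero)
  refine h.congr' EventuallyEq.rfl ?_
  filter_upwards [self_mem_nhdsWithin] with t (ht : 0 < t)
  rw [Function.comp_apply, Real.inv_rpow ht.le, ← Real.rpow_neg ht.le, neg_neg, Real.sqrt_eq_rpow,
    ← Real.rpow_neg ht.le, ← Real.rpow_add ht]
  ring_nf

lemma thetaTail_isBigO_zero : thetaTail =O[𝓝[>] 0] fun t => t ^ (-(1 / 2) : ℝ) := by
  have hsqrt : (fun t : ℝ => (√t)⁻¹) =O[𝓝[>] 0] fun t => t ^ (-(1 / 2) : ℝ) := by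
    refine EventuallyEq.isBigO ?_
    filter_upwards [self_mem_nhdsWithin] with t (ht : 0 < t)
    rw [Real.rpow_neg ht.le, ← Real.sqrt_eq_rpow]
  have hone : (fun _ => (1 : ℝ)) =O[𝓝[>] 0] fun t : ℝ => t ^ (-(1 / 2) : ℝ) := by
    refine IsBigO.of_bound 1 ?_
    filter_upwards [Ioo_mem_nhdsGT one_pos] with t ht
    rw [norm_one, one_mul, Real.norm_of_nonneg (Real.rpow_nonneg ht.1.le _)]
    exact Real.one_le_rpow_of_pos_of_le_one_of_nonpos ht.1 ht.2.le (by norm_num)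
  refine (((hsqrt.const_mul_left (1 / 2)).sub (hone.const_mul_left (1 / 2))).add
    (dualThetaTail_isBigO_zero _)).congr_left fun t => ?_
  rw [thetaTail_eq_dualThetaTail]
  ring

lemma dualThetaTail_isBigO_atTop : dualThetaTail =O[atTop] fun t => t ^ (0 : ℝ) := by
  have h := (isBigO_refl (fun t : ℝ => (√t)⁻¹) atTop).mul
    (thetaTail_isBigO_zero.comp_tendsto tendsto_inv_atTop_nhdsGT_zero)
  refine h.congr' EventuallyEq.rfl ?_
  filter_upwards [eventually_gt_atTop 0] with t ht
  rw [Function.comp_apply, Real.inv_rpow ht.le, ← Real.rpow_neg ht.le, neg_neg,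
    ← Real.sqrt_eq_rpow, inv_mul_cancel₀ (Real.sqrt_pos.2 ht).ne', Real.rpow_zero]

lemma hasMellin_congr {f g : ℝ → ℂ} {s m : ℂ} (hfg : EqOn f g (Ioi 0)) (hf : HasMellin f s m) :
    HasMellin g s m := by
  have heq : EqOn (fun t : ℝ => (t : ℂ) ^ (s - 1) • f t) (fun t => (t : ℂ) ^ (s - 1) • g t)
      (Ioi 0) := fun t ht => by simp only [hfg ht]
  exact ⟨(integrableOn_congr_fun heq measurableSet_Ioi).1 hf.1,
    (setIntegral_congr_fun measurableSet_Ioi heq).symm.trans hf.2⟩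

lemma hasMellin_thetaTail {s : ℂ} (hs : 1 / 2 < s.re) :
    HasMellin (fun t => (thetaTail t : ℂ)) s (completedRiemannZeta (2 * s)) := by
  have h := hasMellin_const_smul ((HurwitzZeta.hurwitzEvenFEPair 0).hasMellin hs).1 (1 / 2 : ℂ)
  rw [((HurwitzZeta.hurwitzEvenFEPair 0).hasMellin hs).2] at h
  have hf : (fun t => (thetaTail t : ℂ)) = fun t => (1 / 2 : ℂ) •
      ((HurwitzZeta.hurwitzEvenFEPair 0).f t - (HurwitzZeta.hurwitzEvenFEPair 0).f₀) := by
    ext t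
    simp only [thetaTail, HurwitzZeta.hurwitzEvenFEPair, Function.comp_apply, if_true, smul_eq_mul]
    push_cast
    ring
  have hΛ : completedRiemannZeta (2 * s) = (1 / 2 : ℂ) • (HurwitzZeta.hurwitzEvenFEPair 0).Λ s := by
    change (HurwitzZeta.hurwitzEvenFEPair 0).Λ (2 * s / 2) / 2 = _
    rw [mul_div_cancel_left₀ s two_ne_zero, smul_eq_mul, one_div_mul_eq_div]
  rwa [hf, hΛ]

lemma hasMellin_thetaTail_comp_mul {a : ℝ} (ha : 0 < a) {s : ℂ} (hs : 1 / 2 < s.re) :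
    HasMellin (fun t => (thetaTail (a * t) : ℂ)) s
      ((a : ℂ) ^ (-s) * completedRiemannZeta (2 * s)) := by
  refine ⟨(MellinConvergent.comp_mul_left ha).2 (hasMellin_thetaTail hs).1, ?_⟩
  rw [mellin_comp_mul_left (fun t => (thetaTail t : ℂ)) s ha, (hasMellin_thetaTail hs).2,
    smul_eq_mul]

lemma hasMellin_inv_sqrt_mul_thetaTail_comp_mul {a : ℝ} (ha : 0 < a) {s : ℂ} (hs : 1 < s.re) :
    HasMellin (fun t => ((√t)⁻¹ * thetaTail (a * t) : ℂ)) s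
      ((a : ℂ) ^ (1 / 2 - s) * completedRiemannZeta (2 * s - 1)) := by
  have hs' : 1 / 2 < (s + (-(1 / 2) : ℝ)).re := by
    rw [Complex.add_re, Complex.ofReal_re]
    linarith
  have h := hasMellin_thetaTail_comp_mul ha hs'
  rw [show 2 * (s + (-(1 / 2) : ℝ)) = 2 * s - 1 by push_cast; ring,
    show -(s + (-(1 / 2) : ℝ)) = 1 / 2 - s by push_cast; ring] at h
  have heq : EqOn (fun t : ℝ => (t : ℂ) ^ ((-(1 / 2) : ℝ) : ℂ) • (thetaTail (a * t) : ℂ))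
      (fun t => ((√t)⁻¹ * thetaTail (a * t) : ℂ)) (Ioi 0) := fun t (ht : 0 < t) => by
    beta_reduce
    rw [smul_eq_mul, ← Complex.ofReal_cpow ht.le, Real.rpow_neg ht.le, ← Real.sqrt_eq_rpow,
      Complex.ofReal_inv]
  exact hasMellin_congr heq ⟨MellinConvergent.cpow_smul.2 h.1, (mellin_cpow_smul _ _ _).trans h.2⟩

/-! ### Heat trace -/

/-- The part of the heat trace `thetaTail (a t) * thetaTail (b t)` that decays rapidly both at `0`
and at `∞`: what the functional equation of the second factor leaves besides powers of `t`. -/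
def heatRemainder (a b t : ℝ) : ℝ := thetaTail (a * t) * dualThetaTail (b * t)

lemma thetaTail_mul_thetaTail (a : ℝ) {b : ℝ} (hb : 0 ≤ b) (t : ℝ) :
    thetaTail (a * t) * thetaTail (b * t) =
      (√b)⁻¹ / 2 * ((√t)⁻¹ * thetaTail (a * t)) - 1 / 2 * thetaTail (a * t) +
        heatRemainder a b t := by
  rw [thetaTail_eq_dualThetaTail (b * t), heatRemainder, Real.sqrt_mul hb, mul_inv]
  ring

lemma continuousOn_comp_mul {f : ℝ → ℝ} {c : ℝ} (hc : 0 < c) (hf : ContinuousOn f (Ioi 0)) :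
    ContinuousOn (fun t => f (c * t)) (Ioi 0) :=
  hf.comp (by fun_prop) fun _ ht => mul_pos hc ht

lemma isBigO_rpow_comp_mul {f : ℝ → ℝ} {l : Filter ℝ} {r c : ℝ} (hc : 0 < c)
    (hl : Tendsto (fun t => c * t) l l) (hpos : ∀ᶠ t in l, 0 < t) (hf : f =O[l] fun t => t ^ r) :
    (fun t => f (c * t)) =O[l] fun t => t ^ r := by
  refine (hf.comp_tendsto hl).trans (IsBigO.of_bound (c ^ r) ?_)
  filter_upwards [hpos] with t ht
  rw [Function.comp_apply, Real.mul_rpow hc.le ht.le, norm_mul,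
    Real.norm_of_nonneg (Real.rpow_nonneg hc.le r)]

section heatRemainder

variable {a b : ℝ}

lemma continuousOn_heatRemainder (ha : 0 < a) (hb : 0 < b) :
    ContinuousOn (heatRemainder a b) (Ioi 0) :=
  (continuousOn_comp_mul ha continuousOn_thetaTail).mul
    (continuousOn_comp_mul hb continuousOn_dualThetaTail)

lemma heatRemainder_isBigO_atTop (ha : 0 < a) (hb : 0 < b) (r : ℝ) :
    heatRemainder a b =O[atTop] fun t => t ^ r := by
  have hpos := eventually_gt_atTop (0 : ℝ)
  refine ((isBigO_rpow_comp_mul ha (tendsto_id.const_mul_atTop ha) hpos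
    (thetaTail_isBigO_atTop r)).mul (isBigO_rpow_comp_mul hb (tendsto_id.const_mul_atTop hb) hpos
    dualThetaTail_isBigO_atTop)).congr_right fun t => ?_
  rw [Real.rpow_zero, mul_one]

lemma heatRemainder_isBigO_zero (ha : 0 < a) (hb : 0 < b) (r : ℝ) :
    heatRemainder a b =O[𝓝[>] 0] fun t => t ^ r := by
  have hpos : ∀ᶠ t in 𝓝[>] (0 : ℝ), 0 < t := self_mem_nhdsWithin
  have htend : ∀ {c : ℝ}, 0 < c → Tendsto (fun t => c * t) (𝓝[>] 0) (𝓝[>] 0) := fun {c} hc =>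
    tendsto_nhdsWithin_iff.2 ⟨by
      simpa using ((continuous_const_mul c).tendsto 0).mono_left nhdsWithin_le_nhds,
      hpos.mono fun t ht => mul_pos hc ht⟩
  refine ((isBigO_rpow_comp_mul ha (htend ha) hpos thetaTail_isBigO_zero).mul
    (isBigO_rpow_comp_mul hb (htend hb) hpos (dualThetaTail_isBigO_zero (r + 1 / 2)))).congr'
    EventuallyEq.rfl ?_
  filter_upwards [hpos] with t ht
  rw [← Real.rpow_add ht]
  ring_nf

lemma locallyIntegrableOn_heatRemainder (ha : 0 < a) (hb : 0 < b) :
    LocallyIntegrableOn (fun t => (heatRemainder a b t : ℂ)) (Ioi 0) :=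
  (Complex.continuous_ofReal.comp_continuousOn
    (continuousOn_heatRemainder ha hb)).locallyIntegrableOn measurableSet_Ioi

lemma mellinConvergent_heatRemainder (ha : 0 < a) (hb : 0 < b) (s : ℂ) :
    MellinConvergent (fun t => (heatRemainder a b t : ℂ)) s :=
  mellinConvergent_of_isBigO_rpow (a := s.re + 1) (b := s.re - 1)
    (locallyIntegrableOn_heatRemainder ha hb)
    (Complex.isBigO_ofReal_left.2 (heatRemainder_isBigO_atTop ha hb _)) (by linarith)
    (Complex.isBigO_ofReal_left.2 (heatRemainder_isBigO_zero ha hb _)) (by linarith)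

lemma differentiable_mellin_heatRemainder (ha : 0 < a) (hb : 0 < b) :
    Differentiable ℂ (mellin fun t => (heatRemainder a b t : ℂ)) := fun s =>
  mellin_differentiableAt_of_isBigO_rpow (a := s.re + 1) (b := s.re - 1)
    (locallyIntegrableOn_heatRemainder ha hb)
    (Complex.isBigO_ofReal_left.2 (heatRemainder_isBigO_atTop ha hb _)) (by linarith)
    (Complex.isBigO_ofReal_left.2 (heatRemainder_isBigO_zero ha hb _)) (by linarith)

end heatRemainder

/-! ### A Lambert series -/

/-- The terms `exp (-2π m k r) / k` of the double series `lambertSum`, where `m` and `k` are one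
more than the indices. -/
def lambertTerm (r : ℝ) (p : ℕ × ℕ) : ℝ :=
  ((p.2 : ℝ) + 1)⁻¹ * Real.exp (-(2 * π * (p.1 + 1) * (p.2 + 1) * r))

/-- The double series `∑ exp (-2π m k r) / k` over positive integers `m`, `k`: minus the logarithm
of the infinite product in `η (i r)`. -/
def lambertSum (r : ℝ) : ℝ := ∑' p : ℕ × ℕ, lambertTerm r p

lemma lambertTerm_pos (r : ℝ) (p : ℕ × ℕ) : 0 < lambertTerm r p := by
  unfold lambertTerm
  positivity

lemma summable_lambertTerm {r : ℝ} (hr : 0 < r) : Summable (lambertTerm r) := by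
  set q := Real.exp (-(2 * π * r)) with hq
  have hq1 : q < 1 := by
    rw [hq, Real.exp_lt_one_iff, neg_lt_zero]
    positivity
  have hg := summable_geometric_of_lt_one (Real.exp_pos _).le hq1
  refine Summable.of_nonneg_of_le (fun p => (lambertTerm_pos r p).le) (fun p => ?_)
    (hg.mul_of_nonneg hg (fun _ => by positivity) fun _ => by positivity)
  have hexp : Real.exp (-(2 * π * (p.1 + 1) * (p.2 + 1) * r)) ≤ q ^ p.1 * q ^ p.2 := by
    rw [hq, ← Real.exp_nat_mul, ← Real.exp_nat_mul, ← Real.exp_add, Real.exp_le_exp]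
    have h : 0 ≤ 2 * π * r * (p.1 * p.2 + 1) := by positivity
    linarith
  calc lambertTerm r p ≤ 1 * (q ^ p.1 * q ^ p.2) :=
        mul_le_mul (inv_le_one_of_one_le₀ (by simp)) hexp (Real.exp_pos _).le zero_le_one
    _ = _ := one_mul _

lemma lambertSum_nonneg (r : ℝ) : 0 ≤ lambertSum r := tsum_nonneg fun p => (lambertTerm_pos r p).le

lemma convexOn_lambertTerm (p : ℕ × ℕ) : ConvexOn ℝ univ fun r => lambertTerm r p := by
  have h := (convexOn_exp.comp_linearMap
    (LinearMap.mulLeft ℝ (-(2 * π * (p.1 + 1) * (p.2 + 1))))).smul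
      (inv_nonneg.2 (by positivity : (0 : ℝ) ≤ p.2 + 1))
  refine h.congr fun r _ => ?_
  simp [lambertTerm]

lemma convexOn_lambertSum : ConvexOn ℝ (Ioi 0) lambertSum := by
  refine ⟨convex_Ioi 0, fun x hx y hy a b ha hb hab => ?_⟩
  have hsum := ((summable_lambertTerm hx).hasSum.mul_left a).add
    ((summable_lambertTerm hy).hasSum.mul_left b)
  exact hasSum_le (fun p => (convexOn_lambertTerm p).2 trivial trivial ha hb hab)
    (summable_lambertTerm (convex_Ioi 0 hx hy ha hb hab)).hasSum hsum

section mellinHeatRemainder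

variable {a b : ℝ}

/-- The terms of the expansion of `heatRemainder a b t / t` as a double series. -/
def heatRemainderTerm (a b : ℝ) (p : ℕ × ℕ) (t : ℝ) : ℝ :=
  (√b)⁻¹ * besselIntegrand (√(π * a) * (p.1 + 1)) (√(π / b) * (p.2 + 1)) t

lemma hasSum_heatRemainderTerm (ha : 0 < a) (hb : 0 < b) {t : ℝ} (ht : 0 < t) :
    HasSum (fun p => heatRemainderTerm a b p t) (t⁻¹ * heatRemainder a b t) := by
  have hm := hasSum_thetaTail (mul_pos ha ht)
  have hk := hasSum_thetaTail (inv_pos.2 (mul_pos hb ht))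
  have h := (hm.mul hk (hm.summable.mul_of_nonneg hk.summable (fun _ => (Real.exp_pos _).le)
    fun _ => (Real.exp_pos _).le)).mul_left (t⁻¹ * (√(b * t))⁻¹)
  have hterm (p) : heatRemainderTerm a b p t = t⁻¹ * (√(b * t))⁻¹ *
      (Real.exp (-(π * (p.1 + 1) ^ 2 * (a * t))) *
        Real.exp (-(π * (p.2 + 1) ^ 2 * (b * t)⁻¹))) := by
    rw [heatRemainderTerm, besselIntegrand, mul_pow, mul_pow, Real.sq_sqrt (by positivity),
      Real.sq_sqrt (by positivity), ← Real.exp_add, Real.sqrt_mul hb.le, mul_inv, mul_inv]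
    ring_nf
  have hsum : t⁻¹ * heatRemainder a b t =
      t⁻¹ * (√(b * t))⁻¹ * (thetaTail (a * t) * thetaTail (b * t)⁻¹) := by
    rw [heatRemainder, dualThetaTail]
    ring
  rw [hsum]
  exact h.congr_fun hterm

lemma integral_heatRemainderTerm (ha : 0 < a) (hb : 0 < b) (p : ℕ × ℕ) :
    ∫ t in Ioi (0 : ℝ), heatRemainderTerm a b p t = lambertTerm √(a / b) p := by
  have hexp : √(π * a) * √(π / b) = π * √(a / b) := by
    rw [← Real.sqrt_mul (by positivity), show π * a * (π / b) = π ^ 2 * (a / b) by ring,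
      Real.sqrt_mul (by positivity), Real.sqrt_sq Real.pi_pos.le]
  have hfactor : (√b)⁻¹ * (√π / √(π / b)) = 1 := by
    rw [Real.sqrt_div Real.pi_pos.le]
    field_simp
  simp only [heatRemainderTerm]
  rw [integral_const_mul, integral_besselIntegrand (by positivity) (by positivity), lambertTerm,
    show 2 * (√(π * a) * ((p.1 : ℝ) + 1)) * (√(π / b) * (p.2 + 1)) =
      2 * (√(π * a) * √(π / b)) * (p.1 + 1) * (p.2 + 1) by ring, hexp, ← mul_assoc]
  congr 1
  · rw [← div_div, ← mul_div_assoc, hfactor, one_div]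
  · ring_nf

lemma heatRemainderTerm_nonneg (a b : ℝ) (p : ℕ × ℕ) {t : ℝ} (ht : 0 < t) :
    0 ≤ heatRemainderTerm a b p t :=
  mul_nonneg (by positivity) (besselIntegrand_nonneg _ _ ht)

lemma integral_inv_mul_heatRemainder (ha : 0 < a) (hb : 0 < b) :
    ∫ t in Ioi (0 : ℝ), t⁻¹ * heatRemainder a b t = lambertSum √(a / b) := by
  have hint (p) : IntegrableOn (heatRemainderTerm a b p) (Ioi 0) :=
    (integrableOn_besselIntegrand (by positivity) (by positivity)).const_mul _
  have hnorm (p) : ∫ t in Ioi (0 : ℝ), ‖heatRemainderTerm a b p t‖ = lambertTerm √(a / b) p := by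
    rw [← integral_heatRemainderTerm ha hb]
    exact setIntegral_congr_fun measurableSet_Ioi fun t ht =>
      Real.norm_of_nonneg (heatRemainderTerm_nonneg a b p ht)
  have hsum := hasSum_integral_of_summable_integral_norm hint
    (by simpa only [hnorm] using summable_lambertTerm (Real.sqrt_pos.2 (div_pos ha hb)))
  simp only [integral_heatRemainderTerm ha hb] at hsum
  rw [lambertSum, hsum.tsum_eq]
  exact setIntegral_congr_fun measurableSet_Ioi fun t ht =>
    (hasSum_heatRemainderTerm ha hb ht).tsum_eq.symm

lemma mellin_heatRemainder_zero (ha : 0 < a) (hb : 0 < b) :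
    mellin (fun t => (heatRemainder a b t : ℂ)) 0 = (lambertSum √(a / b) : ℂ) := by
  rw [← integral_inv_mul_heatRemainder ha hb, ← integral_complex_ofReal, mellin]
  refine setIntegral_congr_fun measurableSet_Ioi fun t _ => ?_
  simp only [zero_sub, Complex.cpow_neg_one, smul_eq_mul, Complex.ofReal_mul, Complex.ofReal_inv]

end mellinHeatRemainder

/-! ### The zeta function of a rectangle -/

/-- The `(m, n)`-th eigenvalue `π (a (m + 1) ^ 2 + b (n + 1) ^ 2)` of the Dirichlet Laplacian on a
rectangle with sides `√(π / a)` and `√(π / b)`. -/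
def rectEigenvalue (a b : ℝ) (p : ℕ × ℕ) : ℝ := π * (a * (p.1 + 1) ^ 2 + b * (p.2 + 1) ^ 2)

/-- The coefficient of `1 / Gamma s` in `rectZeta a b s`. -/
def rectZetaGammaCoeff (a b : ℝ) (s : ℂ) : ℂ :=
  ((√b)⁻¹ / 2 : ℝ) * ((a : ℂ) ^ (1 / 2 - s) * completedRiemannZeta (2 * s - 1)) +
    mellin (fun t => (heatRemainder a b t : ℂ)) s

/-- The meromorphic continuation of the sum of `rectEigenvalue a b p ^ (-s)` over `p`. -/
def rectZeta (a b : ℝ) (s : ℂ) : ℂ :=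
  -(1 / 2) * (((π * a : ℝ) : ℂ) ^ (-s) * riemannZeta (2 * s)) +
    rectZetaGammaCoeff a b s * (Complex.Gamma s)⁻¹

lemma cpow_mul_completedRiemannZeta_eq {a : ℝ} (ha : 0 < a) {s : ℂ} (hs : 0 < s.re) :
    (a : ℂ) ^ (-s) * completedRiemannZeta (2 * s) =
      ((π * a : ℝ) : ℂ) ^ (-s) * riemannZeta (2 * s) * Complex.Gamma s := by
  have hs0 : 2 * s ≠ 0 := mul_ne_zero two_ne_zero fun h => by simp [h] at hs
  have hπ : (π : ℂ) ^ (-s) ≠ 0 := by simp [Complex.cpow_eq_zero_iff, Real.pi_ne_zero]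
  rw [riemannZeta_def_of_ne_zero hs0, Complex.Gammaℝ_def, neg_div,
    mul_div_cancel_left₀ s two_ne_zero, Complex.ofReal_mul,
    Complex.mul_cpow_ofReal_nonneg Real.pi_pos.le ha.le]
  field_simp [Complex.Gamma_ne_zero_of_re_pos hs]

section

variable {a b : ℝ}

lemma rectEigenvalue_pos (ha : 0 < a) (hb : 0 < b) (p : ℕ × ℕ) : 0 < rectEigenvalue a b p := by
  unfold rectEigenvalue
  positivity

lemma mul_le_rectEigenvalue (ha : 0 < a) (hb : 0 < b) (p : ℕ × ℕ) :
    2 * π * √a * √b * ((p.1 + 1) * (p.2 + 1)) ≤ rectEigenvalue a b p := by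
  have hsq := two_mul_le_add_sq (√a * (p.1 + 1)) (√b * (p.2 + 1))
  rw [mul_pow, mul_pow, Real.sq_sqrt ha.le, Real.sq_sqrt hb.le] at hsq
  calc _ = π * (2 * (√a * (p.1 + 1)) * (√b * (p.2 + 1))) := by ring
    _ ≤ _ := mul_le_mul_of_nonneg_left hsq Real.pi_pos.le

lemma summable_rectEigenvalue_rpow (ha : 0 < a) (hb : 0 < b) {σ : ℝ} (hσ : 1 < σ) :
    Summable fun p => 1 / rectEigenvalue a b p ^ σ := by
  have h : Summable fun n : ℕ => 1 / ((n : ℝ) + 1) ^ σ := by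
    simpa using (summable_nat_add_iff 1).2 (Real.summable_one_div_nat_rpow.2 hσ)
  refine Summable.of_nonneg_of_le
    (fun p => one_div_nonneg.2 (Real.rpow_nonneg (rectEigenvalue_pos ha hb p).le _)) (fun p => ?_)
    ((h.mul_of_nonneg h (fun _ => by positivity) fun _ => by positivity).mul_left
      (1 / (2 * π * √a * √b) ^ σ))
  rw [one_div_mul_one_div, one_div_mul_one_div, ← Real.mul_rpow (by positivity) (by positivity),
    ← Real.mul_rpow (by positivity) (by positivity)]
  exact one_div_le_one_div_of_le (by positivity)
    (Real.rpow_le_rpow (by positivity) (mul_le_rectEigenvalue ha hb p) (by linarith))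

lemma hasSum_exp_neg_rectEigenvalue_mul (ha : 0 < a) (hb : 0 < b) {t : ℝ} (ht : 0 < t) :
    HasSum (fun p => Real.exp (-rectEigenvalue a b p * t))
      (thetaTail (a * t) * thetaTail (b * t)) := by
  have hm := hasSum_thetaTail (mul_pos ha ht)
  have hn := hasSum_thetaTail (mul_pos hb ht)
  refine (hm.mul hn (hm.summable.mul_of_nonneg hn.summable (fun _ => (Real.exp_pos _).le)
      fun _ => (Real.exp_pos _).le)).congr_fun fun p => ?_
  rw [← Real.exp_add, rectEigenvalue]
  ring_nf

lemma mellin_thetaTail_mul_thetaTail (ha : 0 < a) (hb : 0 < b) {s : ℂ} (hs : 1 < s.re) :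
    mellin (fun t => ((thetaTail (a * t) * thetaTail (b * t) : ℝ) : ℂ)) s =
      Complex.Gamma s * rectZeta a b s := by
  have hsqrt := hasMellin_inv_sqrt_mul_thetaTail_comp_mul ha hs
  have hone := hasMellin_thetaTail_comp_mul ha (show 1 / 2 < s.re by linarith)
  have hsub := hasMellin_sub (hsqrt.1.const_smul (((√b)⁻¹ / 2 : ℝ) : ℂ))
    (hone.1.const_smul (1 / 2 : ℂ))
  have hadd := (hasMellin_add hsub.1 (mellinConvergent_heatRemainder ha hb s)).2
  rw [hsub.2, mellin_const_smul, mellin_const_smul, hsqrt.2, hone.2,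
    cpow_mul_completedRiemannZeta_eq ha (by linarith)] at hadd
  have hΓ := Complex.Gamma_ne_zero_of_re_pos (show 0 < s.re by linarith)
  calc _ = _ := by
        congr 1
        ext t
        rw [thetaTail_mul_thetaTail a hb.le]
        simp only [smul_eq_mul]
        push_cast
        rfl
    _ = _ := hadd
    _ = _ := by
        rw [rectZeta, rectZetaGammaCoeff]
        simp only [smul_eq_mul]
        field_simp
        ring

lemma hasSum_rectZeta (ha : 0 < a) (hb : 0 < b) {s : ℂ} (hs : 1 < s.re) :
    HasSum (fun p => (rectEigenvalue a b p : ℂ) ^ (-s)) (rectZeta a b s) := by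
  have h := hasSum_mellin (a := fun _ : ℕ × ℕ => (1 : ℂ)) (s := s) (p := rectEigenvalue a b)
    (F := fun t => ((thetaTail (a * t) * thetaTail (b * t) : ℝ) : ℂ))
    (fun p => Or.inr (rectEigenvalue_pos ha hb p)) (by linarith)
    (fun t ht => by
      simpa only [one_mul] using
        Complex.hasSum_ofReal.2 (hasSum_exp_neg_rectEigenvalue_mul ha hb ht))
    (by simpa only [norm_one] using summable_rectEigenvalue_rpow ha hb hs)
  have hΓ : Complex.Gamma s ≠ 0 := Complex.Gamma_ne_zero_of_re_pos (by linarith)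
  have hmul := h.mul_left (Complex.Gamma s)⁻¹
  rw [mellin_thetaTail_mul_thetaTail ha hb hs, inv_mul_cancel_left₀ hΓ] at hmul
  refine hmul.congr_fun fun p => ?_
  rw [Complex.cpow_neg, mul_one, div_eq_mul_inv, inv_mul_cancel_left₀ hΓ]

end

lemma analyticAt_riemannZeta {s : ℂ} (hs : s ≠ 1) : AnalyticAt ℂ riemannZeta s :=
  differentiableOn_riemannZeta.analyticAt (isOpen_compl_singleton.mem_nhds hs)

lemma meromorphicAt_riemannZeta (s : ℂ) : MeromorphicAt riemannZeta s := by
  have h : MeromorphicAt (fun s : ℂ => (s - 1)⁻¹ + riemannZeta₀ s) s :=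
    ((AnalyticAt.meromorphicAt (by fun_prop)).inv).add
      (differentiable_riemannZeta₀.analyticAt s).meromorphicAt
  have hne : ∀ᶠ z in 𝓝[≠] s, z ≠ 1 := by
    rcases eq_or_ne s 1 with rfl | hs
    exacts [self_mem_nhdsWithin, eventually_ne_nhdsWithin hs]
  exact h.congr (hne.mono fun z hz => (riemannZeta_eq_inv_sub_add hz).symm)

lemma analyticAt_completedRiemannZeta {s : ℂ} (hs0 : s ≠ 0) (hs1 : s ≠ 1) :
    AnalyticAt ℂ completedRiemannZeta s :=
  DifferentiableOn.analyticAt (s := {0, 1}ᶜ)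
    (fun z hz => by
      simp only [mem_compl_iff, mem_insert_iff, mem_singleton_iff, not_or] at hz
      exact (differentiableAt_completedZeta hz.1 hz.2).differentiableWithinAt)
    ((toFinite _).isClosed.isOpen_compl.mem_nhds (by simp [hs0, hs1]))

lemma meromorphicAt_completedRiemannZeta (s : ℂ) : MeromorphicAt completedRiemannZeta s := by
  have h : MeromorphicAt (fun z => completedRiemannZeta₀ z - 1 / z - 1 / (1 - z)) s :=
    ((differentiable_completedZeta₀.analyticAt s).meromorphicAt.sub
      ((MeromorphicAt.const 1 s).div (AnalyticAt.meromorphicAt (by fun_prop)))).sub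
      ((MeromorphicAt.const 1 s).div (AnalyticAt.meromorphicAt (by fun_prop)))
  exact h.congr (.of_forall fun z => (completedRiemannZeta_eq z).symm)

lemma completedRiemannZeta_neg_one : completedRiemannZeta (-1) = (π / 6 : ℝ) := by
  have hΓ : Complex.Gammaℝ 2 = (π : ℂ)⁻¹ := by
    rw [Complex.Gammaℝ_def, neg_div, div_self two_ne_zero, Complex.cpow_neg_one, Complex.Gamma_one,
      mul_one]
  have hξ := riemannZeta_def_of_ne_zero (two_ne_zero (α := ℂ))
  rw [riemannZeta_two, hΓ, div_inv_eq_mul] at hξ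
  have hπ : (π : ℂ) ≠ 0 := Complex.ofReal_ne_zero.2 Real.pi_ne_zero
  rw [show (-1 : ℂ) = 1 - 2 by norm_num, completedRiemannZeta_one_sub, ← mul_left_inj' hπ, ← hξ]
  push_cast
  ring

lemma differentiable_inv_Gamma : Differentiable ℂ fun s => (Complex.Gamma s)⁻¹ := by
  simpa only [one_div] using Complex.differentiable_one_div_Gamma

lemma hasDerivAt_inv_Gamma_zero : HasDerivAt (fun s => (Complex.Gamma s)⁻¹) 1 0 := by
  have heq : (fun s => (Complex.Gamma s)⁻¹) = fun s => s * (Complex.Gamma (s + 1))⁻¹ := by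
    ext s
    simpa only [one_div] using Complex.one_div_Gamma_eq_self_mul_one_div_Gamma_add_one s
  have hdiff : DifferentiableAt ℂ (fun s => (Complex.Gamma (s + 1))⁻¹) 0 :=
    (differentiable_inv_Gamma.comp (differentiable_id.add_const 1)) 0
  rw [heq]
  refine ((hasDerivAt_id (0 : ℂ)).mul hdiff.hasDerivAt).congr_deriv ?_
  simp

lemma differentiable_ofReal_cpow_comp {a : ℝ} (ha : 0 < a) {g : ℂ → ℂ} (hg : Differentiable ℂ g) :
    Differentiable ℂ fun s => (a : ℂ) ^ g s := fun s =>
  (hg s).const_cpow (Or.inl (Complex.ofReal_ne_zero.2 ha.ne'))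

section

variable {a b : ℝ}

lemma analyticAt_rectZetaGammaCoeff_zero (ha : 0 < a) (hb : 0 < b) :
    AnalyticAt ℂ (rectZetaGammaCoeff a b) 0 := by
  have hξ : AnalyticAt ℂ (fun s : ℂ => completedRiemannZeta (2 * s - 1)) 0 :=
    (analyticAt_completedRiemannZeta (by norm_num) (by norm_num)).fun_comp
      (f := fun s : ℂ => 2 * s - 1) (by fun_prop)
  exact (analyticAt_const.mul (((differentiable_ofReal_cpow_comp ha (by fun_prop)).analyticAt
    0).mul hξ)).add ((differentiable_mellin_heatRemainder ha hb).analyticAt 0)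

lemma rectZetaGammaCoeff_zero (ha : 0 < a) (hb : 0 < b) :
    rectZetaGammaCoeff a b 0 = (π / 12 * √(a / b) + lambertSum √(a / b) : ℝ) := by
  have hpow : (a : ℂ) ^ (1 / 2 - 0 : ℂ) = (√a : ℝ) := by
    rw [sub_zero, Real.sqrt_eq_rpow, Complex.ofReal_cpow ha.le]
    norm_num
  rw [rectZetaGammaCoeff, hpow, mul_zero, zero_sub, completedRiemannZeta_neg_one,
    mellin_heatRemainder_zero ha hb, Real.sqrt_div ha.le]
  push_cast
  ring

lemma analyticAt_rectZeta_zero (ha : 0 < a) (hb : 0 < b) : AnalyticAt ℂ (rectZeta a b) 0 := by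
  have hζ : AnalyticAt ℂ (fun s : ℂ => riemannZeta (2 * s)) 0 :=
    (analyticAt_riemannZeta (by norm_num)).fun_comp (by fun_prop)
  exact (analyticAt_const.mul (((differentiable_ofReal_cpow_comp (mul_pos Real.pi_pos ha)
    (by fun_prop)).analyticAt 0).mul hζ)).add
    ((analyticAt_rectZetaGammaCoeff_zero ha hb).mul (differentiable_inv_Gamma.analyticAt 0))

lemma meromorphicOn_rectZeta (ha : 0 < a) (hb : 0 < b) :
    MeromorphicOn (rectZeta a b) univ := fun s _ => by
  have hζ : MeromorphicAt (fun s : ℂ => riemannZeta (2 * s)) s :=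
    (meromorphicAt_riemannZeta _).comp_analyticAt (by fun_prop)
  have hξ : MeromorphicAt (fun s : ℂ => completedRiemannZeta (2 * s - 1)) s :=
    (meromorphicAt_completedRiemannZeta _).comp_analyticAt (g := fun s : ℂ => 2 * s - 1)
      (by fun_prop)
  have hpow {c : ℝ} (hc : 0 < c) {g : ℂ → ℂ} (hg : Differentiable ℂ g) :
      MeromorphicAt (fun s => (c : ℂ) ^ g s) s :=
    ((differentiable_ofReal_cpow_comp hc hg).analyticAt s).meromorphicAt
  have hcoeff : MeromorphicAt (rectZetaGammaCoeff a b) s :=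
    ((MeromorphicAt.const _ s).mul ((hpow ha (by fun_prop)).mul hξ)).add
      ((differentiable_mellin_heatRemainder ha hb).analyticAt s).meromorphicAt
  exact ((MeromorphicAt.const _ s).mul ((hpow (mul_pos Real.pi_pos ha) (by fun_prop)).mul hζ)).add
    (hcoeff.mul (differentiable_inv_Gamma.analyticAt s).meromorphicAt)

lemma hasDerivAt_rectZeta_zero (ha : 0 < a) (hb : 0 < b) :
    HasDerivAt (rectZeta a b) ((-Real.log (π * a) / 4 + Real.log (2 * π) / 2 +
      π / 12 * √(a / b) + lambertSum √(a / b) : ℝ) : ℂ) 0 := by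
  have hπa : 0 < π * a := mul_pos Real.pi_pos ha
  have hpow : HasDerivAt (fun s : ℂ => ((π * a : ℝ) : ℂ) ^ (-s)) (-(Real.log (π * a) : ℂ)) 0 := by
    refine ((hasDerivAt_id (0 : ℂ)).neg.const_cpow
      (Or.inl (Complex.ofReal_ne_zero.2 hπa.ne'))).congr_deriv ?_
    simp [Complex.ofReal_log hπa.le]
  have hζ : HasDerivAt (fun s : ℂ => riemannZeta (2 * s)) (-(Real.log (2 * π) : ℂ)) 0 := by
    have h0 : HasDerivAt riemannZeta (-Complex.log (2 * π) / 2) (2 * 0) := by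
      rw [mul_zero, ← deriv_riemannZeta_zero]
      exact (differentiableAt_riemannZeta zero_ne_one).hasDerivAt
    refine (h0.comp (0 : ℂ) ((hasDerivAt_id (0 : ℂ)).const_mul 2)).congr_deriv ?_
    rw [Complex.ofReal_log (by positivity)]
    push_cast
    ring
  refine (((hpow.mul hζ).const_mul (-(1 / 2) : ℂ)).add
    ((analyticAt_rectZetaGammaCoeff_zero ha hb).differentiableAt.hasDerivAt.mul
      hasDerivAt_inv_Gamma_zero)).congr_deriv ?_
  rw [rectZetaGammaCoeff_zero ha hb, mul_zero, riemannZeta_zero, neg_zero, Complex.cpow_zero,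
    Complex.Gamma_zero]
  push_cast
  ring

end

/-! ### Uniqueness of the continuation -/

lemma eventuallyEq_nhds_of_meromorphicOn {U : Set ℂ} (hU : IsPreconnected U) {f g : ℂ → ℂ}
    (hf : MeromorphicOn f U) (hg : MeromorphicOn g U) {x y : ℂ} (hx : x ∈ U) (hy : y ∈ U)
    (hfy : AnalyticAt ℂ f y) (hgy : AnalyticAt ℂ g y) (hfg : f =ᶠ[𝓝[≠] x] g) : f =ᶠ[𝓝 y] g := by
  have horder (z : ℂ) : meromorphicOrderAt (f - g) z = ⊤ ↔ f =ᶠ[𝓝[≠] z] g := by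
    simp only [meromorphicOrderAt_eq_top_iff, Pi.sub_apply, sub_eq_zero, EventuallyEq]
  have hy' : meromorphicOrderAt (f - g) y = ⊤ := by
    by_contra hne
    exact (hf.sub hg).meromorphicOrderAt_ne_top_of_isPreconnected hU hy hx hne ((horder x).2 hfg)
  exact (hfy.frequently_eq_iff_eventually_eq hgy).1 ((horder y).1 hy').frequently

lemma deriv_zero_eq_of_meromorphicOn {f g : ℂ → ℂ} (hf : MeromorphicOn f univ)
    (hg : MeromorphicOn g univ) (hf0 : AnalyticAt ℂ f 0) (hg0 : AnalyticAt ℂ g 0)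
    (hfg : ∀ s : ℂ, 1 < s.re → f s = g s) : deriv f 0 = deriv g 0 := by
  have hopen : IsOpen {s : ℂ | 1 < s.re} := isOpen_lt continuous_const Complex.continuous_re
  have htwo : f =ᶠ[𝓝[≠] 2] g := nhdsWithin_le_nhds
    (eventually_of_mem (hopen.mem_nhds (show (1 : ℝ) < (2 : ℂ).re by norm_num)) hfg)
  exact (eventuallyEq_nhds_of_meromorphicOn isPreconnected_univ hf hg (mem_univ 2) (mem_univ 0)
    hf0 hg0 htwo).deriv_eq

lemma deriv_rectZeta_zero_comm {a b : ℝ} (ha : 0 < a) (hb : 0 < b) :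
    deriv (rectZeta a b) 0 = deriv (rectZeta b a) 0 := by
  refine deriv_zero_eq_of_meromorphicOn (meromorphicOn_rectZeta ha hb)
    (meromorphicOn_rectZeta hb ha)
    (analyticAt_rectZeta_zero ha hb) (analyticAt_rectZeta_zero hb ha) fun s hs => ?_
  refine (hasSum_rectZeta ha hb hs).unique
    (((Equiv.prodComm ℕ ℕ).hasSum_iff.2 (hasSum_rectZeta hb ha hs)).congr_fun fun p => ?_)
  simp only [Function.comp_apply, Equiv.prodComm_apply, rectEigenvalue, Prod.fst_swap,
    Prod.snd_swap, add_comm]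

/-! ### The logarithm of the determinant -/

/-- Up to an additive constant, the logarithm of the determinant of the Dirichlet Laplacian on a
rectangle with unit area and quotient of sides `r`. -/
def logDet (r : ℝ) : ℝ := Real.log r / 4 - π / 12 * r - lambertSum r

lemma deriv_rectZeta_zero_eq_logDet {r : ℝ} (hr : 0 < r) :
    deriv (rectZeta (π * r) (π * r⁻¹)) 0 = ((Real.log 2 / 2 - logDet r : ℝ) : ℂ) := by
  have hquot : √(π * r / (π * r⁻¹)) = r := by
    rw [mul_div_mul_left _ _ Real.pi_ne_zero, div_inv_eq_mul, Real.sqrt_mul_self hr.le]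
  rw [(hasDerivAt_rectZeta_zero (by positivity) (by positivity)).deriv, hquot, logDet,
    Real.log_mul Real.pi_ne_zero (by positivity), Real.log_mul Real.pi_ne_zero hr.ne',
    Real.log_mul two_ne_zero Real.pi_ne_zero]
  ring_nf

lemma logDet_inv {r : ℝ} (hr : 0 < r) : logDet r⁻¹ = logDet r := by
  have h := deriv_rectZeta_zero_comm (a := π * r) (b := π * r⁻¹) (by positivity) (by positivity)
  have hinv := deriv_rectZeta_zero_eq_logDet (inv_pos.2 hr)
  rw [inv_inv, ← h, deriv_rectZeta_zero_eq_logDet hr, Complex.ofReal_inj] at hinv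
  linarith

lemma strictConcaveOn_logDet : StrictConcaveOn ℝ (Ioi 0) logDet := by
  refine ⟨convex_Ioi 0, fun x hx y hy hxy a b ha hb hab => ?_⟩
  have hlog := strictConcaveOn_log_Ioi.2 hx hy hxy ha hb hab
  have hsum := convexOn_lambertSum.2 hx hy ha.le hb.le hab
  simp only [logDet, smul_eq_mul] at hlog hsum ⊢
  linarith

lemma logDet_lt_logDet_one {r : ℝ} (hr : 0 < r) (hr1 : r ≠ 1) : logDet r < logDet 1 := by
  have hne : r ≠ r⁻¹ := fun h => hr1 (by
    have hsq : r * r = 1 := by nth_rewrite 2 [h]; exact mul_inv_cancel₀ hr.ne'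
    nlinarith)
  have hab : 1 / (1 + r) + r / (1 + r) = 1 := by field_simp
  have hone : (1 / (1 + r)) * r + (r / (1 + r)) * r⁻¹ = 1 := by field_simp; ring
  have h := strictConcaveOn_logDet.2 (mem_Ioi.2 hr) (mem_Ioi.2 (inv_pos.2 hr)) hne
    (show 0 < 1 / (1 + r) by positivity) (show 0 < r / (1 + r) by positivity) hab
  simpa only [smul_eq_mul, hone, logDet_inv hr, ← add_mul, hab, one_mul] using h

lemma tendsto_logDet_atTop : Tendsto logDet atTop atBot := by
  have hπ := Real.pi_gt_three
  have hlin : Tendsto (fun r : ℝ => -((π - 3) / 12) * r) atTop atBot :=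
    tendsto_id.const_mul_atTop_of_neg (by linarith)
  refine tendsto_atBot_mono' _ ?_ hlin
  filter_upwards [eventually_gt_atTop 0] with r hr
  have hlog := Real.log_le_sub_one_of_pos hr
  have hsum := lambertSum_nonneg r
  simp only [logDet]
  linarith

lemma tendsto_logDet_zero : Tendsto logDet (𝓝[>] 0) atBot := by
  refine (tendsto_logDet_atTop.comp tendsto_inv_nhdsGT_zero).congr' ?_
  filter_upwards [self_mem_nhdsWithin] with r hr using logDet_inv hr

/-! ### The Dedekind eta function on the imaginary axis -/

lemma hasSum_log_one_sub_exp {r : ℝ} (hr : 0 < r) :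
    HasSum (fun m : ℕ => Real.log (1 - Real.exp (-(2 * π * r)) ^ (m + 1))) (-lambertSum r) := by
  have hq : Real.exp (-(2 * π * r)) < 1 := by
    rw [Real.exp_lt_one_iff, neg_lt_zero]
    positivity
  have h := (summable_lambertTerm hr).hasSum.prod_fiberwise
    (g := fun m : ℕ => -Real.log (1 - Real.exp (-(2 * π * r)) ^ (m + 1))) fun m => by
      have hx : |Real.exp (-(2 * π * r)) ^ (m + 1)| < 1 := by
        rw [abs_of_pos (by positivity)]
        exact pow_lt_one₀ (Real.exp_pos _).le hq m.succ_ne_zero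
      refine (Real.hasSum_pow_div_log_of_abs_lt_one hx).congr_fun fun k => ?_
      rw [lambertTerm, ← pow_mul, ← Real.exp_nat_mul, div_eq_inv_mul]
      push_cast
      ring_nf
  simpa only [neg_neg] using! h.neg

lemma hasProd_one_sub_eta_q {r : ℝ} (hr : 0 < r) :
    HasProd (fun m : ℕ => 1 - ModularForm.eta_q m (Complex.I * r))
      (Real.exp (-lambertSum r) : ℂ) := by
  have hq : Real.exp (-(2 * π * r)) < 1 := by
    rw [Real.exp_lt_one_iff, neg_lt_zero]
    positivity
  have h := (hasSum_log_one_sub_exp hr).rexp.map Complex.ofRealHom Complex.continuous_ofReal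
  refine h.congr_fun fun m => ?_
  have hx : 0 < 1 - Real.exp (-(2 * π * r)) ^ (m + 1) :=
    sub_pos.2 (pow_lt_one₀ (Real.exp_pos _).le hq m.succ_ne_zero)
  have hexp : 2 * (π : ℂ) * Complex.I * (Complex.I * r) = -(2 * π * r) := by
    linear_combination (2 * π * r : ℂ) * Complex.I_mul_I
  rw [ModularForm.eta_q_eq_pow, hexp]
  simp only [Function.comp_apply, Real.exp_log hx, Complex.ofRealHom_eq_coe]
  push_cast
  rfl

lemma norm_eta_I_mul {r : ℝ} (hr : 0 < r) :
    ‖ModularForm.eta (Complex.I * r)‖ = Real.exp (-(π / 12 * r) - lambertSum r) := by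
  rw [ModularForm.eta, (hasProd_one_sub_eta_q hr).tprod_eq, norm_mul,
    Function.Periodic.norm_qParam, Complex.norm_real, Real.norm_of_nonneg (Real.exp_pos _).le,
    ← Real.exp_add]
  congr 1
  simp only [Complex.mul_im, Complex.I_re, Complex.I_im, Complex.ofReal_re, Complex.ofReal_im]
  ring

lemma sqrt_norm_eta_sq_div_eq_exp_logDet {r : ℝ} (hr : 0 < r) :
    √(√r * ‖ModularForm.eta (Complex.I * r)‖ ^ 2 / 2) = Real.exp (logDet r - Real.log 2 / 2) := by
  have hsqrt : √r / 2 = Real.exp (Real.log r / 2 - Real.log 2) := by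
    rw [Real.exp_sub, Real.exp_log two_pos, ← Real.log_sqrt hr.le,
      Real.exp_log (Real.sqrt_pos.2 hr)]
  rw [mul_div_right_comm, hsqrt, norm_eta_I_mul hr, ← Real.exp_nat_mul, ← Real.exp_add,
    Real.sqrt_eq_rpow, ← Real.exp_mul, logDet]
  push_cast
  ring_nf

/-! ### Smooth eigenfunctions -/

lemma laplacian_eq_sum_fderiv_fderiv {E ι : Type*} [NormedAddCommGroup E] [InnerProductSpace ℝ E]
    [FiniteDimensional ℝ E] [Fintype ι] (v : OrthonormalBasis ι ℝ E) {f : E → ℝ}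
    (hf : ContDiff ℝ 2 f) (x : E) :
    Δ f x = ∑ i, fderiv ℝ (fun y => fderiv ℝ f y (v i)) x (v i) := by
  have hdiff : DifferentiableAt ℝ (fderiv ℝ f) x :=
    (hf.fderiv_right (m := 1) (by norm_num)).differentiable one_ne_zero x
  rw [InnerProductSpace.laplacian_eq_iteratedFDeriv_orthonormalBasis f v]
  refine Finset.sum_congr rfl fun i _ => ?_
  rw [iteratedFDeriv_two_apply, fderiv_clm_apply hdiff (differentiableAt_const _)]
  simp

lemma inner_gradient_eq_sum_fderiv_mul {E ι : Type*} [NormedAddCommGroup E]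
    [InnerProductSpace ℝ E] [CompleteSpace E] [Fintype ι] (v : OrthonormalBasis ι ℝ E)
    {f g : E → ℝ} {x : E} (hf : DifferentiableAt ℝ f x) (hg : DifferentiableAt ℝ g x) :
    ⟪∇ f x, ∇ g x⟫ = ∑ i, fderiv ℝ f x (v i) * fderiv ℝ g x (v i) := by
  rw [← v.sum_inner_mul_inner]
  refine Finset.sum_congr rfl fun i _ => ?_
  rw [real_inner_comm (∇ g x) (v i), hf.hasGradientAt.fderiv_apply, hg.hasGradientAt.fderiv_apply]

lemma integral_inner_gradient_eq_neg_integral_laplacian_mul {E : Type*} [NormedAddCommGroup E]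
    [InnerProductSpace ℝ E] [FiniteDimensional ℝ E] [MeasurableSpace E] [BorelSpace E]
    {f φ : E → ℝ} (hf : ContDiff ℝ 2 f) (hφ : ContDiff ℝ 1 φ) (hφc : HasCompactSupport φ) :
    ∫ x, ⟪∇ f x, ∇ φ x⟫ = -∫ x, Δ f x * φ x := by
  set v := stdOrthonormalBasis ℝ E
  have hfd := hf.differentiable two_ne_zero
  have hφd := hφ.differentiable one_ne_zero
  have hf1 (i) : ContDiff ℝ 1 fun x => fderiv ℝ f x (v i) :=
    (hf.fderiv_right (by norm_num)).clm_apply contDiff_const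
  have hf2 (i) : Continuous fun x => fderiv ℝ (fun y => fderiv ℝ f y (v i)) x (v i) :=
    ((hf1 i).continuous_fderiv one_ne_zero).clm_apply continuous_const
  have hφ1 (i) : Continuous fun x => fderiv ℝ φ x (v i) :=
    (hφ.continuous_fderiv one_ne_zero).clm_apply continuous_const
  have hint1 (i) : Integrable fun x => fderiv ℝ f x (v i) * fderiv ℝ φ x (v i) :=
    ((hf1 i).continuous.mul (hφ1 i)).integrable_of_hasCompactSupport
      (hφc.fderiv_apply ℝ _).mul_left
  have hint2 (i) : Integrable fun x => fderiv ℝ (fun y => fderiv ℝ f y (v i)) x (v i) * φ x :=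
    ((hf2 i).mul hφ.continuous).integrable_of_hasCompactSupport hφc.mul_left
  have hint3 (i) : Integrable fun x => fderiv ℝ f x (v i) * φ x :=
    ((hf1 i).continuous.mul hφ.continuous).integrable_of_hasCompactSupport hφc.mul_left
  calc ∫ x, ⟪∇ f x, ∇ φ x⟫ = ∑ i, ∫ x, fderiv ℝ f x (v i) * fderiv ℝ φ x (v i) := by
        simp only [fun x => inner_gradient_eq_sum_fderiv_mul v (hfd x) (hφd x)]
        exact integral_finsetSum _ fun i _ => hint1 i
    _ = ∑ i, -∫ x, fderiv ℝ (fun y => fderiv ℝ f y (v i)) x (v i) * φ x :=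
        Finset.sum_congr rfl fun i _ => integral_mul_fderiv_eq_neg_fderiv_mul_of_integrable
          (hint2 i) (hint1 i) (hint3 i) (fun x _ => (hf1 i).differentiable one_ne_zero x)
          fun x _ => hφd x
    _ = -∫ x, Δ f x * φ x := by
        simp only [laplacian_eq_sum_fderiv_fderiv v hf, Finset.sum_mul]
        rw [integral_finsetSum _ fun i _ => hint2 i, Finset.sum_neg_distrib]

variable {Ω : Opens Plane}

lemma inner_eq_neg_inner_of_mem_sobolevH10 {f : Plane → ℝ} (hf : ContDiff ℝ 2 f) {G : L2Vec Ω}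
    {D : L2 Ω} (hG : G =ᵐ[volume.restrict (Ω : Set Plane)] ∇ f)
    (hD : D =ᵐ[volume.restrict (Ω : Set Plane)] Δ f) {w : L2 Ω × L2Vec Ω}
    (hw : w ∈ sobolevH10 Ω) : inner ℝ G w.2 = -inner ℝ D w.1 := by
  have hclosed : IsClosed {w : L2 Ω × L2Vec Ω | inner ℝ G w.2 = -inner ℝ D w.1} :=
    isClosed_eq (by fun_prop) (by fun_prop)
  refine closure_minimal (s := (testGradientGraph Ω : Set _)) ?_ hclosed
    (show w ∈ closure (testGradientGraph Ω : Set _) from hw)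
  rintro p ⟨φ, hφ, hφ'⟩
  have hφ0 : ∀ x ∉ (Ω : Set Plane), φ x = 0 := fun x hx =>
    image_eq_zero_of_notMem_tsupport fun h => hx (φ.tsupport_subset h)
  have hφ1 : ∀ x ∉ (Ω : Set Plane), ∇ (φ : Plane → ℝ) x = 0 := fun x hx => by
    rw [gradient, image_eq_zero_of_notMem_tsupport fun h =>
      hx (φ.tsupport_subset (tsupport_fderiv_subset ℝ h)), map_zero]
  calc inner ℝ G p.2 = ∫ x in (Ω : Set Plane), ⟪∇ f x, ∇ (φ : Plane → ℝ) x⟫ := by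
        rw [L2.inner_def]
        refine integral_congr_ae ?_
        filter_upwards [hG, hφ'] with x h1 h2 using by rw [h1, h2]
    _ = -∫ x in (Ω : Set Plane), Δ f x * φ x := by
        rw [setIntegral_eq_integral_of_forall_compl_eq_zero fun x hx => by
            rw [hφ1 x hx, inner_zero_right],
          setIntegral_eq_integral_of_forall_compl_eq_zero fun x hx => by rw [hφ0 x hx, mul_zero],
          integral_inner_gradient_eq_neg_integral_laplacian_mul hf
            (φ.contDiff.of_le (by simp)) φ.hasCompactSupport]
    _ = -inner ℝ D p.1 := by
        rw [L2.inner_def]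
        congr 1
        refine integral_congr_ae ?_
        filter_upwards [hD, hφ] with x h1 h2
        rw [h1, h2, RCLike.inner_apply', conj_trivial]

lemma mem_eigenspace_of_laplacian_eq {f : Plane → ℝ} {μ : ℝ} (hf : ContDiff ℝ 2 f)
    (hΔ : ∀ x, Δ f x = -(μ * f x)) {u : L2 Ω} {G : L2Vec Ω}
    (hu : u =ᵐ[volume.restrict (Ω : Set Plane)] f)
    (hG : G =ᵐ[volume.restrict (Ω : Set Plane)] ∇ f) (hmem : (u, G) ∈ sobolevH10 Ω) :
    u ∈ eigenspace Ω μ := by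
  refine ⟨G, hmem, fun w hw => ?_⟩
  have hD : ((-μ) • u : L2 Ω) =ᵐ[volume.restrict (Ω : Set Plane)] Δ f := by
    filter_upwards [hu, Lp.coeFn_smul (-μ) u] with x h1 h2
    rw [h2, Pi.smul_apply, h1, hΔ, smul_eq_mul, neg_mul]
  rw [inner_eq_neg_inner_of_mem_sobolevH10 hf hG hD hw]
  simp

/-! ### A criterion for membership in `H¹₀` -/

lemma tendsto_toLp_of_forall_norm_le {α E : Type*} [MeasurableSpace α] [NormedAddCommGroup E]
    {p : ENNReal} [Fact (1 ≤ p)] (hp : p ≠ ⊤) {μ : Measure α} [IsFiniteMeasure μ] {f : ℕ → α → E}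
    {g : α → E} (hf : ∀ n, MemLp (f n) p μ) (hg : MemLp g p μ) {C : ℝ}
    (hbound : ∀ n, ∀ᵐ x ∂μ, ‖f n x‖ ≤ C)
    (hlim : ∀ᵐ x ∂μ, Tendsto (fun n => f n x) atTop (𝓝 (g x))) :
    Tendsto (fun n => (hf n).toLp (f n)) atTop (𝓝 (hg.toLp g)) := by
  have hunif : UnifIntegrable f p μ := by
    refine unifIntegrable_of Fact.out hp (fun n => (hf n).aestronglyMeasurable)
      fun ε _ => ⟨(C + 1).toNNReal, fun n => ?_⟩
    have hzero : {x | (C + 1).toNNReal ≤ ‖f n x‖₊}.indicator (f n) =ᵐ[μ] 0 := by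
      filter_upwards [hbound n] with x hx
      refine indicator_of_notMem (fun h => ?_) _
      have h' : C + 1 ≤ ‖f n x‖ := Real.toNNReal_le_iff_le_coe.1 h
      linarith
    rw [eLpNorm_congr_ae hzero, eLpNorm_zero]
    exact zero_le
  rw [Lp.tendsto_Lp_iff_tendsto_eLpNorm'']
  exact tendsto_Lp_finite_of_tendsto_ae Fact.out hp (fun n => (hf n).aestronglyMeasurable) hg
    hunif hlim

lemma norm_gradient_eq_norm_fderiv {E : Type*} [NormedAddCommGroup E] [InnerProductSpace ℝ E]
    [CompleteSpace E] (f : E → ℝ) (x : E) : ‖∇ f x‖ = ‖fderiv ℝ f x‖ :=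
  (InnerProductSpace.toDual ℝ E).symm.norm_map _

lemma continuous_gradient {E : Type*} [NormedAddCommGroup E] [InnerProductSpace ℝ E]
    [CompleteSpace E] {f : E → ℝ} (hf : ContDiff ℝ 1 f) : Continuous (∇ f) :=
  (InnerProductSpace.toDual ℝ E).symm.continuous.comp (hf.continuous_fderiv one_ne_zero)

lemma mem_sobolevH10_of_tendsto [IsFiniteMeasure (volume.restrict (Ω : Set Plane))]
    {φ : ℕ → 𝓓(Ω, ℝ)} {C : ℝ} (hφ : ∀ n, ∀ x ∈ Ω, |φ n x| ≤ C)
    (hφ' : ∀ n, ∀ x ∈ Ω, ‖∇ (φ n : Plane → ℝ) x‖ ≤ C) {u : L2 Ω} {G : L2Vec Ω}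
    (hu : ∀ᵐ x ∂volume.restrict (Ω : Set Plane), Tendsto (fun n => φ n x) atTop (𝓝 (u x)))
    (hG : ∀ᵐ x ∂volume.restrict (Ω : Set Plane),
      Tendsto (fun n => ∇ (φ n : Plane → ℝ) x) atTop (𝓝 (G x))) :
    (u, G) ∈ sobolevH10 Ω := by
  have hae {p : Plane → Prop} (hp : ∀ x ∈ Ω, p x) : ∀ᵐ x ∂volume.restrict (Ω : Set Plane), p x :=
    (ae_restrict_mem Ω.isOpen.measurableSet).mono hp
  have hφL (n) : MemLp (φ n) 2 (volume.restrict (Ω : Set Plane)) :=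
    .of_bound (φ n).continuous.aestronglyMeasurable C (hae (hφ n))
  have hφL' (n) : MemLp (∇ (φ n : Plane → ℝ)) 2 (volume.restrict (Ω : Set Plane)) :=
    .of_bound (continuous_gradient ((φ n).contDiff.of_le (by simp))).aestronglyMeasurable C
      (hae (hφ' n))
  have htend := (tendsto_toLp_of_forall_norm_le ENNReal.ofNat_ne_top hφL (Lp.memLp u)
    (fun n => hae (hφ n)) hu).prodMk_nhds (tendsto_toLp_of_forall_norm_le ENNReal.ofNat_ne_top
      hφL' (Lp.memLp G) (fun n => hae (hφ' n)) hG)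
  rw [Lp.toLp_coeFn, Lp.toLp_coeFn] at htend
  exact mem_closure_of_tendsto htend
    (.of_forall fun n => ⟨φ n, (hφL n).coeFn_toLp, (hφL' n).coeFn_toLp⟩)

lemma exists_testFunction_eqOn {K : Set Plane} (hK : IsCompact K) (hKΩ : K ⊆ Ω) {f : Plane → ℝ}
    (hf : ContDiff ℝ ∞ f) (hf0 : ∀ x ∈ (Ω : Set Plane) \ K, f x = 0) :
    ∃ φ : 𝓓(Ω, ℝ), EqOn φ f Ω := by
  have hzero : ∀ x ∉ K, (Ω : Set Plane).indicator f x = 0 := fun x hx =>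
    indicator_apply_eq_zero.2 fun hxΩ => hf0 x ⟨hxΩ, hx⟩
  refine ⟨⟨(Ω : Set Plane).indicator f, contDiff_iff_contDiffAt.2 fun x => ?_,
    .intro hK hzero, (closure_minimal (fun x hx => ?_) hK.isClosed).trans hKΩ⟩,
    fun x hx => indicator_of_mem hx f⟩
  · by_cases hx : x ∈ (Ω : Set Plane)
    · exact hf.contDiffAt.congr_of_eventuallyEq <|
        eventuallyEq_of_mem (Ω.isOpen.mem_nhds hx) fun y hy => indicator_of_mem hy f
    · exact (contDiffAt_const (c := (0 : ℝ))).congr_of_eventuallyEq <|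
        eventuallyEq_of_mem (hK.isClosed.isOpen_compl.mem_nhds fun h => hx (hKΩ h)) hzero
  · by_contra h
    exact hx (hzero x h)

/-- A smooth function of `t`, equal to `0` for `c * t ≤ 1` and to `t` for `2 ≤ c * t`: it cuts off
a positive function near its zeros while increasing its gradient by a bounded factor only. -/
def shrink (c t : ℝ) : ℝ := t * Real.smoothTransition (c * t - 1)

lemma contDiff_shrink (c : ℝ) : ContDiff ℝ ∞ (shrink c) :=
  contDiff_id.mul (Real.smoothTransition.contDiff.comp (by fun_prop))

lemma shrink_of_mul_le_one {c t : ℝ} (h : c * t ≤ 1) : shrink c t = 0 := by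
  rw [shrink, Real.smoothTransition.zero_of_nonpos (by linarith), mul_zero]

lemma shrink_of_two_le_mul {c t : ℝ} (h : 2 ≤ c * t) : shrink c t = t := by
  rw [shrink, Real.smoothTransition.one_of_one_le (by linarith), mul_one]

lemma abs_shrink_le (c t : ℝ) : |shrink c t| ≤ |t| := by
  rw [shrink, abs_mul, abs_of_nonneg (Real.smoothTransition.nonneg _)]
  exact mul_le_of_le_one_right (abs_nonneg t) (Real.smoothTransition.le_one _)

lemma deriv_shrink (c t : ℝ) : deriv (shrink c) t = deriv (shrink 1) (c * t) := by
  obtain rfl | hc := eq_or_ne c 0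
  · have h0 : shrink 0 = fun _ => 0 := funext fun t => shrink_of_mul_le_one (by simp)
    have h1 : shrink 1 =ᶠ[𝓝 0] fun _ => 0 := eventuallyEq_of_mem (Iio_mem_nhds zero_lt_one)
      fun t ht => shrink_of_mul_le_one (by rw [one_mul]; exact le_of_lt ht)
    rw [zero_mul, h0, h1.deriv_eq, deriv_const, deriv_const]
  · have hscale : shrink c = fun t => c⁻¹ * shrink 1 (c * t) := by
      ext t
      rw [shrink, shrink, one_mul, ← mul_assoc, inv_mul_cancel_left₀ hc]
    rw [hscale, deriv_const_mul_field, deriv_comp_mul_left, smul_eq_mul, inv_mul_cancel_left₀ hc]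

lemma exists_forall_abs_deriv_shrink_le : ∃ C, ∀ c t, |deriv (shrink c) t| ≤ C := by
  obtain ⟨C, hC⟩ := (isCompact_Icc (a := (1 : ℝ)) (b := 2)).exists_bound_of_continuousOn
    ((contDiff_shrink 1).continuous_deriv (by simp)).continuousOn
  refine ⟨max C 1, fun c t => ?_⟩
  rw [deriv_shrink]
  generalize c * t = s
  obtain hs | hs := lt_or_ge s 1
  · have h : shrink 1 =ᶠ[𝓝 s] fun _ => 0 := eventuallyEq_of_mem (Iio_mem_nhds hs)
      fun t ht => shrink_of_mul_le_one (by rw [one_mul]; exact le_of_lt ht)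
    simp [h.deriv_eq]
  obtain hs' | hs' := le_or_gt s 2
  · exact (hC s ⟨hs, hs'⟩).trans (le_max_left _ _)
  · have h : shrink 1 =ᶠ[𝓝 s] id := eventuallyEq_of_mem (Ioi_mem_nhds hs')
      fun t ht => shrink_of_two_le_mul (by rw [one_mul]; exact le_of_lt ht)
    simp [h.deriv_eq]

lemma eventually_shrink_eventuallyEq_id {t : ℝ} (ht : 0 < t) :
    ∀ᶠ N : ℕ in atTop, shrink N =ᶠ[𝓝 t] id := by
  filter_upwards [((tendsto_natCast_atTop_atTop (R := ℝ)).atTop_mul_const ht).eventually_gt_atTop 2]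
    with N hN
  filter_upwards [(continuous_const_mul (N : ℝ)).continuousAt.eventually (Ioi_mem_nhds hN)]
    with s hs
  exact shrink_of_two_le_mul (le_of_lt hs)

lemma norm_fderiv_shrink_comp_mul_le {E : Type*} [NormedAddCommGroup E] [NormedSpace ℝ E]
    {ρ g : E → ℝ} {x : E} (hρ : DifferentiableAt ℝ ρ x) (hg : DifferentiableAt ℝ g x) (c : ℝ) :
    ‖fderiv ℝ (fun y => shrink c (ρ y) * g y) x‖ ≤
      |ρ x| * ‖fderiv ℝ g x‖ + |g x| * (|deriv (shrink c) (ρ x)| * ‖fderiv ℝ ρ x‖) := by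
  have hshrink := (contDiff_shrink c).differentiable (by simp) (ρ x)
  have hcomp := hshrink.hasDerivAt.comp_hasFDerivAt x hρ.hasFDerivAt
  rw [HasFDerivAt.fderiv (f := fun y => shrink c (ρ y) * g y) (hcomp.mul hg.hasFDerivAt)]
  refine (norm_add_le _ _).trans ?_
  simp only [norm_smul, Real.norm_eq_abs, Function.comp_apply]
  gcongr ?_ * _ + _
  exact abs_shrink_le c _

lemma exists_forall_shrink_comp_mul_le {E : Type*} [NormedAddCommGroup E] [NormedSpace ℝ E]
    {s : Set E} (hs : IsCompact s) {ρ g : E → ℝ} (hρ : ContDiff ℝ 1 ρ) (hg : ContDiff ℝ 1 g) :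
    ∃ C, ∀ c, ∀ x ∈ s, |shrink c (ρ x) * g x| ≤ C ∧
      ‖fderiv ℝ (fun y => shrink c (ρ y) * g y) x‖ ≤ C := by
  obtain ⟨M, hM⟩ := exists_forall_abs_deriv_shrink_le
  obtain ⟨A, hA⟩ := hs.exists_bound_of_continuousOn (f := fun x => |ρ x| * |g x|)
    (hρ.continuous.abs.mul hg.continuous.abs).continuousOn
  obtain ⟨B, hB⟩ := hs.exists_bound_of_continuousOn
    (f := fun x => |ρ x| * ‖fderiv ℝ g x‖ + |g x| * (M * ‖fderiv ℝ ρ x‖))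
    ((hρ.continuous.abs.mul (hg.continuous_fderiv one_ne_zero).norm).add (hg.continuous.abs.mul
      ((hρ.continuous_fderiv one_ne_zero).norm.const_mul M))).continuousOn
  refine ⟨max A B, fun c x hx => ⟨?_, ?_⟩⟩
  · calc |shrink c (ρ x) * g x| ≤ |ρ x| * |g x| := by
          rw [abs_mul]
          gcongr ?_ * _
          exact abs_shrink_le c _
      _ ≤ A := (le_abs_self _).trans (hA x hx)
      _ ≤ max A B := le_max_left _ _
  · calc ‖fderiv ℝ (fun y => shrink c (ρ y) * g y) x‖
        ≤ |ρ x| * ‖fderiv ℝ g x‖ + |g x| * (|deriv (shrink c) (ρ x)| * ‖fderiv ℝ ρ x‖) :=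
          norm_fderiv_shrink_comp_mul_le (hρ.differentiable one_ne_zero x)
            (hg.differentiable one_ne_zero x) c
      _ ≤ |ρ x| * ‖fderiv ℝ g x‖ + |g x| * (M * ‖fderiv ℝ ρ x‖) := by
          gcongr
          exact hM c _
      _ ≤ B := (le_abs_self _).trans (hB x hx)
      _ ≤ max A B := le_max_right _ _

lemma exists_testFunction_eqOn_shrink_comp_mul (hΩ : IsCompact (closure (Ω : Set Plane)))
    {ρ g : Plane → ℝ} (hρ : ContDiff ℝ ∞ ρ) (hg : ContDiff ℝ ∞ g)
    (hρ_frontier : ∀ x ∈ frontier (Ω : Set Plane), ρ x = 0) (c : ℝ) :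
    ∃ φ : 𝓓(Ω, ℝ), EqOn φ (fun x => shrink c (ρ x) * g x) Ω := by
  refine exists_testFunction_eqOn (K := closure Ω ∩ {x | 1 ≤ c * ρ x})
    (hΩ.inter_right (isClosed_le continuous_const (continuous_const.mul hρ.continuous))) ?_
    (((contDiff_shrink c).comp hρ).mul hg) ?_
  · rintro x ⟨hx, hx'⟩
    by_contra hxΩ
    rw [mem_ofPred_eq, hρ_frontier x ⟨hx, by rwa [Ω.isOpen.interior_eq]⟩, mul_zero] at hx'
    exact absurd hx' (by norm_num)
  · rintro x ⟨hx, hx'⟩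
    rw [shrink_of_mul_le_one (not_le.1 fun h => hx' ⟨subset_closure hx, h⟩).le, zero_mul]

theorem mul_mem_sobolevH10 (hΩ : Bornology.IsBounded (Ω : Set Plane)) {ρ g : Plane → ℝ}
    (hρ : ContDiff ℝ ∞ ρ) (hg : ContDiff ℝ ∞ g) (hρ_pos : ∀ x ∈ Ω, 0 < ρ x)
    (hρ_frontier : ∀ x ∈ frontier (Ω : Set Plane), ρ x = 0) {u : L2 Ω} {G : L2Vec Ω}
    (hu : u =ᵐ[volume.restrict (Ω : Set Plane)] fun x => ρ x * g x)
    (hG : G =ᵐ[volume.restrict (Ω : Set Plane)] ∇ fun x => ρ x * g x) :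
    (u, G) ∈ sobolevH10 Ω := by
  have hcompact : IsCompact (closure (Ω : Set Plane)) := hΩ.isCompact_closure
  have : IsFiniteMeasure (volume.restrict (Ω : Set Plane)) :=
    isFiniteMeasure_restrict.2 (measure_mono subset_closure |>.trans_lt hcompact.measure_lt_top).ne
  obtain ⟨C, hC⟩ := exists_forall_shrink_comp_mul_le hcompact (hρ.of_le (by simp))
    (hg.of_le (by simp))
  choose φ hφ using fun N : ℕ =>
    exists_testFunction_eqOn_shrink_comp_mul hcompact hρ hg hρ_frontier N
  have hφ_nhds (N) {x} (hx : x ∈ Ω) : φ N =ᶠ[𝓝 x] fun x => shrink N (ρ x) * g x :=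
    eventuallyEq_of_mem (Ω.isOpen.mem_nhds hx) (hφ N)
  have hlim {x} (hx : x ∈ Ω) : ∀ᶠ N in atTop, φ N =ᶠ[𝓝 x] fun x => ρ x * g x := by
    filter_upwards [eventually_shrink_eventuallyEq_id (hρ_pos x hx)] with N hN
    filter_upwards [hφ_nhds N hx, hρ.continuous.continuousAt.eventually hN] with y h1 h2
    rw [h1, h2, id]
  have hmem := ae_restrict_mem (μ := volume) Ω.isOpen.measurableSet
  refine mem_sobolevH10_of_tendsto (φ := φ) (C := C) (fun N x hx => ?_) (fun N x hx => ?_) ?_ ?_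
  · rw [hφ N hx]
    exact (hC N x (subset_closure hx)).1
  · rw [norm_gradient_eq_norm_fderiv, (hφ_nhds N hx).fderiv_eq]
    exact (hC N x (subset_closure hx)).2
  · filter_upwards [hmem, hu] with x hx hux
    rw [hux]
    exact tendsto_const_nhds.congr' ((hlim hx).mono fun N hN => hN.eq_of_nhds.symm)
  · filter_upwards [hmem, hG] with x hx hGx
    rw [hGx]
    exact tendsto_const_nhds.congr' ((hlim hx).mono fun N hN =>
      congrArg (InnerProductSpace.toDual ℝ Plane).symm hN.fderiv_eq.symm)

/-! ### Spectral zeta functions from an eigenbasis -/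

lemma inner_eq_zero_of_mem_eigenspace {u v : L2 Ω} {μ ν : ℝ} (hu : u ∈ eigenspace Ω μ)
    (hv : v ∈ eigenspace Ω ν) (hμν : μ ≠ ν) : inner ℝ u v = 0 := by
  obtain ⟨G, hG, hGu⟩ := hu
  obtain ⟨K, hK, hKv⟩ := hv
  have h1 : inner ℝ G K = μ * inner ℝ u v := by
    simpa [real_inner_smul_left] using hGu (v, K) hK
  have h2 : inner ℝ K G = ν * inner ℝ v u := by
    simpa [real_inner_smul_left] using hKv (u, G) hG
  rw [real_inner_comm, real_inner_comm u v] at h2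
  by_contra h
  exact hμν (mul_right_cancel₀ h (h1.symm.trans h2))

section Eigenbasis

variable {ι : Type*} (b : HilbertBasis ι ℝ (L2 Ω)) {lam : ι → ℝ}

lemma eigenspace_eq_span_image (hb : ∀ i, b i ∈ eigenspace Ω (lam i))
    {μ : ℝ} (hfin : (lam ⁻¹' {μ}).Finite) :
    eigenspace Ω μ = Submodule.span ℝ (b '' (lam ⁻¹' {μ})) := by
  refine le_antisymm (fun u hu => ?_) (Submodule.span_le.2 ?_)
  · have hzero : ∀ i ∉ hfin.toFinset, b.repr u i • b i = 0 := fun i hi => by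
      rw [b.repr_apply_apply, inner_eq_zero_of_mem_eigenspace (hb i) hu (by simpa using hi),
        zero_smul]
    rw [(b.hasSum_repr u).unique (hasSum_sum_of_ne_finset_zero hzero)]
    exact Submodule.sum_mem _ fun i hi =>
      Submodule.smul_mem _ _ (Submodule.subset_span ⟨i, hfin.mem_toFinset.1 hi, rfl⟩)
  · rintro _ ⟨i, rfl, rfl⟩
    exact hb i

lemma finiteDimensional_eigenspace (hb : ∀ i, b i ∈ eigenspace Ω (lam i))
    {μ : ℝ} (hfin : (lam ⁻¹' {μ}).Finite) :
    FiniteDimensional ℝ (eigenspace Ω μ) := by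
  rw [eigenspace_eq_span_image b hb hfin]
  exact .span_of_finite ℝ (hfin.image b)

lemma finrank_eigenspace (hb : ∀ i, b i ∈ eigenspace Ω (lam i))
    {μ : ℝ} (hfin : (lam ⁻¹' {μ}).Finite) :
    Module.finrank ℝ (eigenspace Ω μ) = (lam ⁻¹' {μ}).ncard := by
  have := hfin.to_subtype
  have := Fintype.ofFinite (lam ⁻¹' {μ})
  rw [eigenspace_eq_span_image b hb hfin, image_eq_range, ← Nat.card_coe_set_eq,
    Nat.card_eq_fintype_card]
  exact finrank_span_eq_card (b.orthonormal.linearIndependent.comp _ Subtype.val_injective)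

lemma hasSum_positiveEigenvalues (hb : ∀ i, b i ∈ eigenspace Ω (lam i))
    (hpos : ∀ i, 0 < lam i) (hfin : ∀ μ, (lam ⁻¹' {μ}).Finite)
    {f : ℝ → ℂ} {a : ℂ} (h : HasSum (fun i => f (lam i)) a) :
    HasSum (fun μ : positiveEigenvalues Ω =>
      (Module.finrank ℝ (eigenspace Ω (μ : ℝ)) : ℂ) * f μ) a := by
  let e (i : ι) : positiveEigenvalues Ω :=
    ⟨lam i, hpos i, (Submodule.ne_bot_iff _).2 ⟨b i, hb i, b.orthonormal.ne_zero i⟩⟩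
  refine ((Equiv.sigmaFiberEquiv e).hasSum_iff.2 h).sigma fun μ => ?_
  have hfiber : e ⁻¹' {μ} = lam ⁻¹' {(μ : ℝ)} := by
    ext i
    exact Subtype.ext_iff
  have hcard : Nat.card {i // e i = μ} = Module.finrank ℝ (eigenspace Ω (μ : ℝ)) := by
    rw [finrank_eigenspace b hb (hfin μ), ← hfiber]
    rfl
  have : Finite {i // e i = μ} := (hfiber ▸ hfin μ : (e ⁻¹' {μ}).Finite).to_subtype
  have := Fintype.ofFinite {i // e i = μ}
  have hsum := hasSum_fintype fun _ : {i // e i = μ} => f μ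
  rw [Finset.sum_const, Finset.card_univ, nsmul_eq_mul, ← Nat.card_eq_fintype_card, hcard] at hsum
  refine hsum.congr_fun ?_
  rintro ⟨i, rfl⟩
  rfl

theorem isSpectralZeta_of_hilbertBasis (hb : ∀ i, b i ∈ eigenspace Ω (lam i))
    (hpos : ∀ i, 0 < lam i) (hfin : ∀ μ, (lam ⁻¹' {μ}).Finite) {Z : ℂ → ℂ}
    (hsum : ∀ s : ℂ, 1 < s.re → HasSum (fun i => (lam i : ℂ) ^ (-s)) (Z s))
    (hmero : MeromorphicOn Z univ) (h0 : AnalyticAt ℂ Z 0) : IsSpectralZeta Ω Z where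
  finite_mult μ _ := finiteDimensional_eigenspace b hb (hfin μ)
  hasSum s hs := hasSum_positiveEigenvalues b hb hpos hfin (f := fun μ => (μ : ℂ) ^ (-s))
    (hsum s hs)
  meromorphic := hmero
  analyticAt_zero := h0

end Eigenbasis

/-! ### Stone–Weierstrass and vanishing integrals -/

lemma exists_mem_subalgebra_forall_abs_sub_lt {X : Type*} [TopologicalSpace X] {K : Set X}
    (hK : IsCompact K) (A : Subalgebra ℝ C(X, ℝ))
    (hsep : ∀ x ∈ K, ∀ y ∈ K, x ≠ y → ∃ f ∈ A, f x ≠ f y) {g : X → ℝ} (hg : ContinuousOn g K)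
    {ε : ℝ} (hε : 0 < ε) : ∃ f ∈ A, ∀ x ∈ K, |f x - g x| < ε := by
  have : CompactSpace K := isCompact_iff_compactSpace.1 hK
  let r : C(X, ℝ) →ₐ[ℝ] C(K, ℝ) :=
    ContinuousMap.compRightAlgHom ℝ ℝ ⟨Subtype.val, continuous_subtype_val⟩
  have hsep' : (A.map r).SeparatesPoints := fun x y hxy => by
    obtain ⟨f, hf, hfxy⟩ := hsep x x.2 y y.2 (Subtype.coe_ne_coe.2 hxy)
    exact ⟨r f, ⟨r f, ⟨f, hf, rfl⟩, rfl⟩, hfxy⟩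
  obtain ⟨⟨_, f, hf, rfl⟩, hfg⟩ :=
    ContinuousMap.exists_mem_subalgebra_near_continuous_of_separatesPoints _ hsep' (K.domRestrict g)
      hg.domRestrict ε hε
  exact ⟨f, hf, fun x hx => hfg ⟨x, hx⟩⟩

lemma integral_mul_eq_zero_of_forall_mem_subalgebra {X : Type*} [TopologicalSpace X]
    [MeasurableSpace X] [OpensMeasurableSpace X] {K : Set X} (hK : IsCompact K) {μ : Measure X}
    (hμ : ∀ᵐ x ∂μ, x ∈ K) (A : Subalgebra ℝ C(X, ℝ))
    (hsep : ∀ x ∈ K, ∀ y ∈ K, x ≠ y → ∃ f ∈ A, f x ≠ f y) {v : X → ℝ} (hv : Integrable v μ)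
    (hA : ∀ f ∈ A, ∫ x, f x * v x ∂μ = 0) {g : X → ℝ} (hg : Continuous g) :
    ∫ x, g x * v x ∂μ = 0 := by
  have hint {f : X → ℝ} (hf : Continuous f) : Integrable (fun x => f x * v x) μ := by
    obtain ⟨C, hC⟩ := hK.exists_bound_of_continuousOn hf.continuousOn
    exact hv.bdd_mul hf.aestronglyMeasurable (hμ.mono hC)
  have hle (ε : ℝ) (hε : 0 < ε) : |∫ x, g x * v x ∂μ| ≤ ε * ∫ x, |v x| ∂μ := by
    obtain ⟨f, hf, hfg⟩ :=
      exists_mem_subalgebra_forall_abs_sub_lt hK A hsep hg.continuousOn hε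
    calc |∫ x, g x * v x ∂μ| = ‖∫ x, (f x * v x - g x * v x) ∂μ‖ := by
          rw [integral_sub (hint f.continuous) (hint hg), hA f hf, zero_sub, norm_neg,
            Real.norm_eq_abs]
      _ ≤ ∫ x, ε * |v x| ∂μ := by
          refine norm_integral_le_of_norm_le (hv.abs.const_mul ε) ?_
          filter_upwards [hμ] with x hx
          rw [← sub_mul, norm_mul]
          exact mul_le_mul_of_nonneg_right (hfg x hx).le (norm_nonneg _)
      _ = ε * ∫ x, |v x| ∂μ := integral_const_mul _ _
  have hlim : Tendsto (fun ε : ℝ => ε * ∫ x, |v x| ∂μ) (𝓝[>] 0) (𝓝 0) :=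
    ((continuous_mul_const _).tendsto' 0 0 (zero_mul _)).mono_left nhdsWithin_le_nhds
  exact abs_nonpos_iff.1 (ge_of_tendsto hlim (eventually_mem_nhdsWithin.mono hle))

lemma ae_eq_zero_of_forall_mem_subalgebra {E : Type*} [NormedAddCommGroup E] [NormedSpace ℝ E]
    [FiniteDimensional ℝ E] [MeasurableSpace E] [BorelSpace E] {K : Set E} (hK : IsCompact K)
    {μ : Measure E} (hμ : ∀ᵐ x ∂μ, x ∈ K) (A : Subalgebra ℝ C(E, ℝ))
    (hsep : ∀ x ∈ K, ∀ y ∈ K, x ≠ y → ∃ f ∈ A, f x ≠ f y) {v : E → ℝ} (hv : Integrable v μ)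
    (hA : ∀ f ∈ A, ∫ x, f x * v x ∂μ = 0) : v =ᵐ[μ] 0 :=
  ae_eq_zero_of_integral_contDiff_smul_eq_zero hv.locallyIntegrable fun _ hg _ =>
    integral_mul_eq_zero_of_forall_mem_subalgebra hK hμ A hsep hv hA hg.continuous

/-! ### The sine basis of an interval -/

/-- The Dirichlet eigenfunctions of the interval `(0, c)`, normalized in `L²(0, c)`. -/
def sineMode (c : ℝ) (m : ℕ) (t : ℝ) : ℝ := √(2 / c) * Real.sin ((m + 1) * (π / c * t))

lemma contDiff_sineMode (c : ℝ) (m : ℕ) : ContDiff ℝ ∞ (sineMode c m) := by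
  unfold sineMode
  fun_prop

lemma deriv_deriv_sineMode (c : ℝ) (m : ℕ) (t : ℝ) :
    deriv (deriv (sineMode c m)) t = -((m + 1) * (π / c)) ^ 2 * sineMode c m t := by
  set k := (m + 1) * (π / c)
  have hsin : sineMode c m = fun t => √(2 / c) * Real.sin (k * t) := by
    ext t
    rw [sineMode, mul_assoc]
  have hderiv : deriv (sineMode c m) = fun t => √(2 / c) * (k * Real.cos (k * t)) := by
    ext t
    rw [hsin, deriv_const_mul_field, deriv_comp_mul_left k Real.sin, Real.deriv_sin, smul_eq_mul]
  rw [hderiv, deriv_const_mul_field, deriv_const_mul_field, deriv_comp_mul_left k Real.cos,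
    Real.deriv_cos, hsin, smul_eq_mul]
  ring

lemma sineMode_zero_pos {c t : ℝ} (ht : t ∈ Ioo 0 c) : 0 < sineMode c 0 t := by
  have hc : 0 < c := ht.1.trans ht.2
  rw [sineMode, Nat.cast_zero, zero_add, one_mul]
  refine mul_pos (by positivity) (Real.sin_pos_of_pos_of_lt_pi ?_ ?_)
  · exact mul_pos (by positivity) ht.1
  · rw [div_mul_eq_mul_div, div_lt_iff₀ hc]
    exact mul_lt_mul_of_pos_left ht.2 Real.pi_pos

lemma sineMode_zero_eq_zero {c t : ℝ} (hc : c ≠ 0) (ht : t ∈ Icc 0 c) (ht' : t ∉ Ioo 0 c) :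
    sineMode c 0 t = 0 := by
  obtain rfl | rfl : t = 0 ∨ t = c := by
    by_contra! h
    exact ht' ⟨ht.1.lt_of_ne' h.1, ht.2.lt_of_ne h.2⟩
  · simp [sineMode]
  · simp [sineMode, hc]

lemma sineMode_eq_sineMode_zero_mul (c : ℝ) (m : ℕ) (t : ℝ) :
    sineMode c m t =
      sineMode c 0 t * (Polynomial.Chebyshev.U ℝ m).eval (Real.cos (π / c * t)) := by
  have h := Polynomial.Chebyshev.U_real_cos (π / c * t) m
  simp only [Int.cast_natCast] at h
  rw [sineMode, sineMode, ← h, Nat.cast_zero, zero_add, one_mul]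
  ring

lemma exists_cos_mul_sineMode_eq (c : ℝ) (m : ℕ) : ∃ (r : ℝ) (k : ℕ), ∀ t,
    Real.cos (π / c * t) * sineMode c m t = 1 / 2 * sineMode c (m + 1) t + r * sineMode c k t := by
  have haux (t : ℝ) : Real.cos t * Real.sin ((m + 1) * t) =
      1 / 2 * Real.sin ((m + 1 + 1) * t) + 1 / 2 * Real.sin (m * t) := by
    rw [show (m + 1 + 1) * t = (m + 1) * t + t by ring, show m * t = (m + 1) * t - t by ring,
      Real.sin_add, Real.sin_sub]
    ring
  cases m with
  | zero =>
    refine ⟨0, 0, fun t => ?_⟩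
    have := haux (π / c * t)
    simp only [sineMode]
    push_cast at this ⊢
    rw [zero_mul (π / c * t), Real.sin_zero, zero_add] at this
    rw [zero_add, zero_mul, add_zero]
    linear_combination √(2 / c) * this
  | succ k =>
    refine ⟨1 / 2, k, fun t => ?_⟩
    have := haux (π / c * t)
    simp only [sineMode]
    push_cast at this ⊢
    linear_combination √(2 / c) * this

lemma injOn_cos_pi_div_mul {c : ℝ} (hc : 0 < c) :
    InjOn (fun t => Real.cos (π / c * t)) (Icc 0 c) := by
  refine Real.injOn_cos.comp (mul_right_injective₀ (by positivity)).injOn fun t ht => ⟨?_, ?_⟩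
  · exact mul_nonneg (by positivity) ht.1
  · rw [div_mul_eq_mul_div, div_le_iff₀ hc]
    exact mul_le_mul_of_nonneg_left ht.2 Real.pi_pos.le

lemma integral_cos_int_mul (k : ℤ) :
    ∫ t in (0 : ℝ)..π, Real.cos (k * t) = if k = 0 then π else 0 := by
  rcases eq_or_ne k 0 with rfl | hk
  · simp
  · rw [if_neg hk, intervalIntegral.integral_comp_mul_left _ (Int.cast_ne_zero.2 hk), integral_cos,
      Real.sin_int_mul_pi, mul_zero, Real.sin_zero, sub_zero, smul_zero]

lemma integral_sineMode_mul_sineMode {c : ℝ} (hc : 0 < c) (m n : ℕ) :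
    ∫ t in 0..c, sineMode c m t * sineMode c n t = if m = n then 1 else 0 := by
  have hprod (x : ℝ) : Real.sin ((m + 1) * x) * Real.sin ((n + 1) * x) =
      1 / 2 * (Real.cos (((m - n : ℤ) : ℝ) * x) - Real.cos (((m + n + 2 : ℤ) : ℝ) * x)) := by
    have h := Real.two_mul_sin_mul_sin ((m + 1) * x) ((n + 1) * x)
    push_cast
    rw [show (m - n : ℝ) * x = (m + 1) * x - (n + 1) * x by ring,
      show (m + n + 2 : ℝ) * x = (m + 1) * x + (n + 1) * x by ring]
    linear_combination 1 / 2 * h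
  have hcos (k : ℤ) : IntervalIntegrable (fun x => Real.cos ((k : ℝ) * x)) volume 0 π :=
    Continuous.intervalIntegrable (by fun_prop) _ _
  calc ∫ t in 0..c, sineMode c m t * sineMode c n t
      = ∫ t in 0..c, 2 / c * (Real.sin ((m + 1) * (π / c * t)) *
          Real.sin ((n + 1) * (π / c * t))) := by
        refine intervalIntegral.integral_congr fun t _ => ?_
        simp only [sineMode]
        rw [mul_mul_mul_comm, Real.mul_self_sqrt (by positivity)]
    _ = 2 / π * ∫ x in 0..π, Real.sin ((m + 1) * x) * Real.sin ((n + 1) * x) := by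
        rw [intervalIntegral.integral_const_mul, intervalIntegral.integral_comp_mul_left
          (fun x => Real.sin ((m + 1) * x) * Real.sin ((n + 1) * x)) (by positivity), mul_zero,
          div_mul_cancel₀ _ hc.ne', smul_eq_mul, ← mul_assoc, inv_div,
          div_mul_div_cancel₀ hc.ne']
    _ = if m = n then 1 else 0 := by
        simp only [hprod]
        rw [intervalIntegral.integral_const_mul, intervalIntegral.integral_sub (hcos _) (hcos _),
          integral_cos_int_mul, integral_cos_int_mul, if_neg (by lia : (m + n + 2 : ℤ) ≠ 0)]
        simp only [sub_eq_zero, Nat.cast_inj]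
        split_ifs
        · rw [sub_zero]
          field_simp
        · ring

/-! ### The Dirichlet eigenfunctions of a rectangle -/

lemma rectangle_eq_preimage_pi (L : ℝ) : (rectangle L : Set Plane) =
    WithLp.ofLp ⁻¹' univ.pi fun i => Ioo 0 (![L, L⁻¹] i) := by
  ext x
  simp only [mem_preimage, mem_univ_pi, Fin.forall_fin_two]
  exact (and_assoc.trans and_assoc).symm.trans and_assoc

lemma isBounded_rectangle (L : ℝ) : Bornology.IsBounded (rectangle L : Set Plane) := by
  rw [rectangle_eq_preimage_pi]
  exact (PiLp.antilipschitzWith_ofLp 2 fun _ : Fin 2 => ℝ).isBounded_preimage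
    (.pi fun _ => Metric.isBounded_Ioo _ _)

lemma closure_rectangle_subset (L : ℝ) :
    closure (rectangle L : Set Plane) ⊆ {x | x 0 ∈ Icc 0 L ∧ x 1 ∈ Icc 0 L⁻¹} := by
  refine closure_minimal (fun x hx => ⟨⟨hx.1.le, hx.2.1.le⟩, hx.2.2.1.le, hx.2.2.2.le⟩) ?_
  exact (isClosed_Icc.preimage (by fun_prop)).inter (isClosed_Icc.preimage (by fun_prop))

lemma setIntegral_rectangle_mul {L : ℝ} (hL : 0 < L) (f g : ℝ → ℝ) :
    ∫ x in (rectangle L : Set Plane), f (x 0) * g (x 1) =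
      (∫ t in 0..L, f t) * ∫ t in 0..L⁻¹, g t := by
  rw [rectangle_eq_preimage_pi, (PiLp.volume_preserving_ofLp (Fin 2)).setIntegral_preimage_emb
    (MeasurableEquiv.toLp 2 (Fin 2 → ℝ)).symm.measurableEmbedding (fun y => f (y 0) * g (y 1)),
    volume_pi, Measure.restrict_pi_pi]
  have h := integral_fintype_prod_eq_prod ![f, g]
    (μ := fun i : Fin 2 => volume.restrict (Ioo 0 (![L, L⁻¹] i)))
  simp only [Fin.prod_univ_two] at h
  rw [intervalIntegral.integral_of_le hL.le, intervalIntegral.integral_of_le (inv_pos.2 hL).le,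
    integral_Ioc_eq_integral_Ioo, integral_Ioc_eq_integral_Ioo]
  exact h

lemma fderiv_coord_mul_coord {f g : ℝ → ℝ} (hf : Differentiable ℝ f) (hg : Differentiable ℝ g)
    (x v : Plane) : fderiv ℝ (fun y : Plane => f (y 0) * g (y 1)) x v =
      v 0 * (deriv f (x 0) * g (x 1)) + v 1 * (f (x 0) * deriv g (x 1)) := by
  have hcoord (i : Fin 2) : HasFDerivAt (fun y : Plane => y i)
      (EuclideanSpace.proj (𝕜 := ℝ) i : Plane →L[ℝ] ℝ) x :=
    (EuclideanSpace.proj (𝕜 := ℝ) i : Plane →L[ℝ] ℝ).hasFDerivAt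
  have h : HasFDerivAt (fun y : Plane => f (y 0) * g (y 1)) _ x :=
    ((hf (x 0)).hasDerivAt.comp_hasFDerivAt x (hcoord 0)).mul
      ((hg (x 1)).hasDerivAt.comp_hasFDerivAt x (hcoord 1))
  rw [h.fderiv]
  simp
  ring

lemma laplacian_coord_mul_coord {f g : ℝ → ℝ} (hf : ContDiff ℝ 2 f) (hg : ContDiff ℝ 2 g)
    (x : Plane) : Δ (fun y : Plane => f (y 0) * g (y 1)) x =
      deriv (deriv f) (x 0) * g (x 1) + f (x 0) * deriv (deriv g) (x 1) := by
  have hf1 := hf.differentiable two_ne_zero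
  have hg1 := hg.differentiable two_ne_zero
  rw [laplacian_eq_sum_fderiv_fderiv (EuclideanSpace.basisFun (Fin 2) ℝ) (by fun_prop)]
  simp [fderiv_coord_mul_coord, hf1, hg1, hf.differentiable_deriv_two, hg.differentiable_deriv_two]

/-- The products of sines vanishing on the boundary of `rectangle L`, normalized in `L²`: the
Dirichlet eigenfunctions of the rectangle. -/
def rectMode (L : ℝ) (p : ℕ × ℕ) : C(Plane, ℝ) where
  toFun x := sineMode L p.1 (x 0) * sineMode L⁻¹ p.2 (x 1)
  continuous_toFun := by
    have := (contDiff_sineMode L p.1).continuous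
    have := (contDiff_sineMode L⁻¹ p.2).continuous
    fun_prop

lemma contDiff_rectMode (L : ℝ) (p : ℕ × ℕ) : ContDiff ℝ ∞ (rectMode L p) := by
  have := contDiff_sineMode L p.1
  have := contDiff_sineMode L⁻¹ p.2
  change ContDiff ℝ ∞ fun x : Plane => sineMode L p.1 (x 0) * sineMode L⁻¹ p.2 (x 1)
  fun_prop

lemma laplacian_rectMode (L : ℝ) (p : ℕ × ℕ) (x : Plane) : Δ (rectMode L p : Plane → ℝ) x =
    -(rectEigenvalue (π * (L ^ 2)⁻¹) (π * (L ^ 2)⁻¹⁻¹) p * rectMode L p x) := by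
  have h := laplacian_coord_mul_coord (contDiff_infty.1 (contDiff_sineMode L p.1) 2)
    (contDiff_infty.1 (contDiff_sineMode L⁻¹ p.2) 2) x
  simp only [deriv_deriv_sineMode] at h
  refine h.trans ?_
  simp only [rectMode, rectEigenvalue, ContinuousMap.coe_mk]
  ring

lemma rectMode_zero_pos {L : ℝ} {x : Plane} (hx : x ∈ rectangle L) : 0 < rectMode L 0 x :=
  mul_pos (sineMode_zero_pos ⟨hx.1, hx.2.1⟩) (sineMode_zero_pos hx.2.2)

lemma rectMode_zero_eq_zero {L : ℝ} (hL : L ≠ 0) {x : Plane}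
    (hx : x ∈ frontier (rectangle L : Set Plane)) : rectMode L 0 x = 0 := by
  obtain ⟨hx0, hx1⟩ := closure_rectangle_subset L (frontier_subset_closure hx)
  have hx' : x ∉ rectangle L := fun h =>
    ((rectangle L).2.frontier_eq ▸ hx).2 h
  by_cases h0 : x 0 ∈ Ioo 0 L
  · have h1 : x 1 ∉ Ioo 0 L⁻¹ := fun h1 => hx' ⟨h0.1, h0.2, h1⟩
    exact mul_eq_zero_of_right _ (sineMode_zero_eq_zero (inv_ne_zero hL) hx1 h1)
  · exact mul_eq_zero_of_left (sineMode_zero_eq_zero hL hx0 h0) _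

lemma exists_rectMode_eq_rectMode_zero_mul (L : ℝ) (p : ℕ × ℕ) :
    ∃ g : Plane → ℝ, ContDiff ℝ ∞ g ∧ ∀ x, rectMode L p x = rectMode L 0 x * g x := by
  have hU (m : ℕ) : ContDiff ℝ ∞ fun t => (Polynomial.Chebyshev.U ℝ m).eval t :=
    by
    simpa using (Polynomial.Chebyshev.U ℝ m).contDiff_aeval ∞
  refine ⟨fun x => (Polynomial.Chebyshev.U ℝ p.1).eval (Real.cos (π / L * x 0)) *
    (Polynomial.Chebyshev.U ℝ p.2).eval (Real.cos (π / L⁻¹ * x 1)), ?_, fun x => ?_⟩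
  · exact ((hU _).comp (by fun_prop)).mul ((hU _).comp (by fun_prop))
  · simp only [rectMode, ContinuousMap.coe_mk, Prod.fst_zero, Prod.snd_zero]
    rw [sineMode_eq_sineMode_zero_mul, sineMode_eq_sineMode_zero_mul L⁻¹]
    ring

lemma memLp_restrict_of_isBounded {E F : Type*} [PseudoMetricSpace E] [ProperSpace E]
    [MeasurableSpace E] [OpensMeasurableSpace E] [NormedAddCommGroup F]
    [SecondCountableTopologyEither E F] {μ : Measure E} [IsFiniteMeasureOnCompacts μ] {s : Set E}
    (hs : Bornology.IsBounded s) {f : E → F} (hf : Continuous f) (p : ENNReal) :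
    MemLp f p (μ.restrict s) := by
  have hcompact := hs.isCompact_closure
  obtain ⟨C, hC⟩ := hcompact.exists_bound_of_continuousOn hf.continuousOn
  have : IsFiniteMeasure (μ.restrict (closure s)) :=
    isFiniteMeasure_restrict.2 hcompact.measure_ne_top
  exact (MemLp.of_bound hf.aestronglyMeasurable C
    (ae_restrict_of_forall_mem measurableSet_closure hC)).mono_measure
    (Measure.restrict_mono subset_closure le_rfl)

/-- The class of `rectMode L p` in `L²` of the rectangle. -/
def rectModeLp (L : ℝ) (p : ℕ × ℕ) : L2 (rectangle L) :=
  (memLp_restrict_of_isBounded (isBounded_rectangle L) (rectMode L p).continuous 2).toLp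

lemma coeFn_rectModeLp (L : ℝ) (p : ℕ × ℕ) :
    rectModeLp L p =ᵐ[volume.restrict (rectangle L : Set Plane)] rectMode L p :=
  MemLp.coeFn_toLp _

lemma inner_rectModeLp_left (L : ℝ) (p : ℕ × ℕ) (u : L2 (rectangle L)) :
    ⟪rectModeLp L p, u⟫ = ∫ x in (rectangle L : Set Plane), rectMode L p x * u x := by
  rw [L2.inner_def]
  refine integral_congr_ae ((coeFn_rectModeLp L p).mono fun x hx => ?_)
  simp only [hx, RCLike.inner_apply, conj_trivial, mul_comm]

lemma orthonormal_rectModeLp {L : ℝ} (hL : 0 < L) : Orthonormal ℝ (rectModeLp L) := by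
  rw [orthonormal_iff_ite]
  intro p q
  calc ⟪rectModeLp L p, rectModeLp L q⟫
      = ∫ x in (rectangle L : Set Plane), (sineMode L p.1 (x 0) * sineMode L q.1 (x 0)) *
          (sineMode L⁻¹ p.2 (x 1) * sineMode L⁻¹ q.2 (x 1)) := by
        rw [inner_rectModeLp_left]
        refine integral_congr_ae ((coeFn_rectModeLp L q).mono fun x hx => ?_)
        simp only [hx]
        exact mul_mul_mul_comm _ _ _ _
    _ = (if p.1 = q.1 then 1 else 0) * (if p.2 = q.2 then 1 else 0) := by
        rw [setIntegral_rectangle_mul hL (fun t => sineMode L p.1 t * sineMode L q.1 t)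
          (fun t => sineMode L⁻¹ p.2 t * sineMode L⁻¹ q.2 t), integral_sineMode_mul_sineMode hL,
          integral_sineMode_mul_sineMode (inv_pos.2 hL)]
    _ = if p = q then 1 else 0 := by
        simp only [Prod.ext_iff, ite_and, ite_mul, one_mul, zero_mul]

lemma rectModeLp_mem_eigenspace {L : ℝ} (hL : L ≠ 0) (p : ℕ × ℕ) : rectModeLp L p ∈
    eigenspace (rectangle L) (rectEigenvalue (π * (L ^ 2)⁻¹) (π * (L ^ 2)⁻¹⁻¹) p) := by
  obtain ⟨g, hg, hpg⟩ := exists_rectMode_eq_rectMode_zero_mul L p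
  have hsmooth := contDiff_rectMode L p
  have hgrad := memLp_restrict_of_isBounded (μ := volume) (isBounded_rectangle L)
    (continuous_gradient (contDiff_infty.1 hsmooth 1)) 2
  refine mem_eigenspace_of_laplacian_eq (contDiff_infty.1 hsmooth 2) (laplacian_rectMode L p)
    (coeFn_rectModeLp L p) hgrad.coeFn_toLp ?_
  refine mul_mem_sobolevH10 (isBounded_rectangle L) (contDiff_rectMode L 0) hg
    (fun _ => rectMode_zero_pos) (fun _ => rectMode_zero_eq_zero hL) ?_ ?_
  · exact (coeFn_rectModeLp L p).trans (.of_forall hpg)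
  · rw [← funext hpg]
    exact hgrad.coeFn_toLp

/-! ### Completeness of the eigenfunctions -/

lemma mul_mem_span_of_mem_adjoin {R A : Type*} [CommSemiring R] [Semiring A] [Algebra R A]
    {s t : Set A} (h : ∀ a ∈ s, ∀ b ∈ t, a * b ∈ Submodule.span R t) {a b : A}
    (ha : a ∈ Algebra.adjoin R s) (hb : b ∈ Submodule.span R t) : a * b ∈ Submodule.span R t := by
  induction ha using Algebra.adjoin_induction generalizing b with
  | mem a ha =>
    have hle : Submodule.span R t ≤ (Submodule.span R t).comap (LinearMap.mulLeft R a) :=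
      Submodule.span_le.2 fun b hb => h a ha b hb
    exact hle hb
  | algebraMap r =>
    rw [← Algebra.smul_def]
    exact Submodule.smul_mem _ r hb
  | add a a' _ _ ha ha' =>
    rw [add_mul]
    exact add_mem (ha hb) (ha' hb)
  | mul a a' _ _ ha ha' =>
    rw [mul_assoc]
    exact ha (ha' hb)

/-- The functions `cos (π x / L)` and `cos (π L y)`, whose products with the eigenfunctions of the
rectangle are combinations of eigenfunctions. -/
def rectCos (L : ℝ) : Fin 2 → C(Plane, ℝ) :=
  ![⟨fun x => Real.cos (π / L * x 0), by fun_prop⟩,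
    ⟨fun x => Real.cos (π / L⁻¹ * x 1), by fun_prop⟩]

lemma rectCos_mul_rectMode_mem_span (L : ℝ) (i : Fin 2) (p : ℕ × ℕ) :
    rectCos L i * rectMode L p ∈ Submodule.span ℝ (range (rectMode L)) := by
  have hmem (c d : ℝ) (q q' : ℕ × ℕ) :
      c • rectMode L q + d • rectMode L q' ∈ Submodule.span ℝ (range (rectMode L)) :=
    add_mem (Submodule.smul_mem _ _ (Submodule.subset_span ⟨q, rfl⟩))
      (Submodule.smul_mem _ _ (Submodule.subset_span ⟨q', rfl⟩))
  fin_cases i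
  · obtain ⟨r, k, h⟩ := exists_cos_mul_sineMode_eq L p.1
    convert hmem (1 / 2) r (p.1 + 1, p.2) (k, p.2) using 1
    ext x
    change Real.cos (π / L * x 0) * (sineMode L p.1 (x 0) * sineMode L⁻¹ p.2 (x 1)) =
      1 / 2 * (sineMode L (p.1 + 1) (x 0) * sineMode L⁻¹ p.2 (x 1)) +
        r * (sineMode L k (x 0) * sineMode L⁻¹ p.2 (x 1))
    linear_combination sineMode L⁻¹ p.2 (x 1) * h (x 0)
  · obtain ⟨r, k, h⟩ := exists_cos_mul_sineMode_eq L⁻¹ p.2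
    convert hmem (1 / 2) r (p.1, p.2 + 1) (p.1, k) using 1
    ext x
    change Real.cos (π / L⁻¹ * x 1) * (sineMode L p.1 (x 0) * sineMode L⁻¹ p.2 (x 1)) =
      1 / 2 * (sineMode L p.1 (x 0) * sineMode L⁻¹ (p.2 + 1) (x 1)) +
        r * (sineMode L p.1 (x 0) * sineMode L⁻¹ k (x 1))
    linear_combination sineMode L p.1 (x 0) * h (x 1)

lemma exists_rectCos_ne {L : ℝ} (hL : 0 < L) {x y : Plane}
    (hx : x ∈ closure (rectangle L : Set Plane)) (hy : y ∈ closure (rectangle L : Set Plane))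
    (hxy : x ≠ y) : ∃ i, rectCos L i x ≠ rectCos L i y := by
  contrapose! hxy
  obtain ⟨hx0, hx1⟩ := closure_rectangle_subset L hx
  obtain ⟨hy0, hy1⟩ := closure_rectangle_subset L hy
  ext i
  fin_cases i
  · exact injOn_cos_pi_div_mul hL hx0 hy0 (hxy 0)
  · exact injOn_cos_pi_div_mul (inv_pos.2 hL) hx1 hy1 (hxy 1)

lemma integral_mul_eq_zero_of_mem_span_rectMode {L : ℝ} {u : L2 (rectangle L)}
    (hu : ∀ p, ⟪rectModeLp L p, u⟫ = 0) {f : C(Plane, ℝ)}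
    (hf : f ∈ Submodule.span ℝ (range (rectMode L))) :
    ∫ x in (rectangle L : Set Plane), f x * u x = 0 := by
  have hint (f : C(Plane, ℝ)) :
      Integrable (fun x => f x * u x) (volume.restrict (rectangle L : Set Plane)) :=
    (memLp_restrict_of_isBounded (isBounded_rectangle L) f.continuous 2).integrable_mul (Lp.memLp u)
  induction hf using Submodule.span_induction with
  | mem f hf =>
    obtain ⟨p, rfl⟩ := hf
    rw [← inner_rectModeLp_left, hu p]
  | zero => simp
  | add f g _ _ hf hg =>
    simp only [ContinuousMap.add_apply, add_mul]
    rw [integral_add (hint f) (hint g), hf, hg, add_zero]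
  | smul r f _ hf =>
    simp only [ContinuousMap.smul_apply, smul_eq_mul, mul_assoc]
    rw [integral_const_mul, hf, mul_zero]

lemma eq_zero_of_forall_inner_rectModeLp_eq_zero {L : ℝ} (hL : 0 < L) {u : L2 (rectangle L)}
    (hu : ∀ p, ⟪rectModeLp L p, u⟫ = 0) : u = 0 := by
  have hmeas : MeasurableSet (rectangle L : Set Plane) := (rectangle L).isOpen.measurableSet
  have hzero : (fun x => rectMode L 0 x * u x) =ᵐ[volume.restrict (rectangle L : Set Plane)] 0 := by
    refine ae_eq_zero_of_forall_mem_subalgebra (isBounded_rectangle L).isCompact_closure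
      (ae_restrict_of_forall_mem hmeas fun x hx => subset_closure hx)
      (Algebra.adjoin ℝ (range (rectCos L))) (fun x hx y hy hxy => ?_) ?_ fun f hf => ?_
    · obtain ⟨i, hi⟩ := exists_rectCos_ne hL hx hy hxy
      exact ⟨_, Algebra.subset_adjoin ⟨i, rfl⟩, hi⟩
    · exact (memLp_restrict_of_isBounded (isBounded_rectangle L)
        (rectMode L 0).continuous 2).integrable_mul (Lp.memLp u)
    · have hspan : f * rectMode L 0 ∈ Submodule.span ℝ (range (rectMode L)) := by
        refine mul_mem_span_of_mem_adjoin ?_ hf (Submodule.subset_span ⟨0, rfl⟩)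
        rintro _ ⟨i, rfl⟩ _ ⟨p, rfl⟩
        exact rectCos_mul_rectMode_mem_span L i p
      simpa only [ContinuousMap.mul_apply, mul_assoc] using
        integral_mul_eq_zero_of_mem_span_rectMode hu hspan
  rw [Lp.eq_zero_iff_ae_eq_zero]
  filter_upwards [hzero, ae_restrict_mem hmeas] with x hx hxL
  exact (mul_eq_zero.1 hx).resolve_left (rectMode_zero_pos hxL).ne'

/-- The orthonormal basis of `L²` of the rectangle consisting of Dirichlet eigenfunctions. -/
def rectBasis {L : ℝ} (hL : 0 < L) : HilbertBasis (ℕ × ℕ) ℝ (L2 (rectangle L)) :=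
  HilbertBasis.mkOfOrthogonalEqBot (orthonormal_rectModeLp hL) <|
    (Submodule.eq_bot_iff _).2 fun _ hu =>
      eq_zero_of_forall_inner_rectModeLp_eq_zero hL fun p =>
        Submodule.inner_right_of_mem_orthogonal (Submodule.subset_span (mem_range_self p)) hu

lemma rectBasis_apply {L : ℝ} (hL : 0 < L) (p : ℕ × ℕ) : rectBasis hL p = rectModeLp L p :=
  congrFun (HilbertBasis.coe_mkOfOrthogonalEqBot _ _) p

/-! ### The determinant of a rectangle -/

lemma finite_preimage_rectEigenvalue {a b : ℝ} (ha : 0 < a) (hb : 0 < b) (μ : ℝ) :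
    (rectEigenvalue a b ⁻¹' {μ}).Finite := by
  obtain h | ⟨q, rfl⟩ := (rectEigenvalue a b ⁻¹' {μ}).eq_empty_or_nonempty
  · exact h ▸ finite_empty
  · have hq : 1 / rectEigenvalue a b q ^ (2 : ℝ) ≠ 0 :=
      (one_div_pos.2 (Real.rpow_pos_of_pos (rectEigenvalue_pos ha hb q) _)).ne'
    have hne := (summable_rectEigenvalue_rpow ha hb one_lt_two).tendsto_cofinite_zero.eventually_ne
      hq.symm
    refine (eventually_cofinite.1 hne).subset fun p hp => ?_
    exact not_not.2 (by rw [mem_preimage.1 hp])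

theorem isSpectralZeta_rectangle {L : ℝ} (hL : 0 < L) :
    IsSpectralZeta (rectangle L) (rectZeta (π * (L ^ 2)⁻¹) (π * (L ^ 2)⁻¹⁻¹)) := by
  have ha : 0 < π * (L ^ 2)⁻¹ := by positivity
  have hb : 0 < π * (L ^ 2)⁻¹⁻¹ := by positivity
  exact isSpectralZeta_of_hilbertBasis (rectBasis hL)
    (fun p => rectBasis_apply hL p ▸ rectModeLp_mem_eigenspace hL.ne' p) (rectEigenvalue_pos ha hb)
    (finite_preimage_rectEigenvalue ha hb) (fun _ => hasSum_rectZeta ha hb)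
    (meromorphicOn_rectZeta ha hb) (analyticAt_rectZeta_zero ha hb)

lemma IsSpectralZeta.deriv_zero_eq {Ω : Opens Plane} {Z W : ℂ → ℂ} (hZ : IsSpectralZeta Ω Z)
    (hW : IsSpectralZeta Ω W) : deriv Z 0 = deriv W 0 :=
  deriv_zero_eq_of_meromorphicOn hZ.meromorphic hW.meromorphic hZ.analyticAt_zero
    hW.analyticAt_zero fun s hs => (hZ.hasSum s hs).unique (hW.hasSum s hs)

lemma isZetaDeterminant_rectangle_iff {L : ℝ} (hL : 0 < L) {d : ℝ} :
    IsZetaDeterminant (rectangle L) d ↔ d = Real.exp (logDet (L ^ 2)⁻¹ - Real.log 2 / 2) := by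
  have hZ := isSpectralZeta_rectangle hL
  have hexp : ((Real.exp (logDet (L ^ 2)⁻¹ - Real.log 2 / 2) : ℝ) : ℂ) =
      Complex.exp (-deriv (rectZeta (π * (L ^ 2)⁻¹) (π * (L ^ 2)⁻¹⁻¹)) 0) := by
    rw [deriv_rectZeta_zero_eq_logDet (by positivity), ← Complex.ofReal_neg, neg_sub,
      Complex.ofReal_exp]
  constructor
  · rintro ⟨W, hW, hd⟩
    rwa [hW.deriv_zero_eq hZ, ← hexp, Complex.ofReal_inj] at hd
  · rintro rfl
    exact ⟨_, hZ, hexp⟩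

theorem zetaDet_rectangle {L : ℝ} (hL : 0 < L) :
    zetaDet (rectangle L) = Real.exp (logDet (L ^ 2)⁻¹ - Real.log 2 / 2) := by
  have h : ∃ d, IsZetaDeterminant (rectangle L) d :=
    ⟨_, (isZetaDeterminant_rectangle_iff hL).2 rfl⟩
  rw [zetaDet, dif_pos h]
  exact (isZetaDeterminant_rectangle_iff hL).1 h.choose_spec

theorem zetaDet_rectangle_eq_sqrt {L : ℝ} (hL : 0 < L) :
    zetaDet (rectangle L) = √(‖ModularForm.eta (Complex.I / (L : ℂ) ^ 2)‖ ^ 2 / (2 * L)) := by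
  rw [zetaDet_rectangle hL, ← sqrt_norm_eta_sq_div_eq_exp_logDet (by positivity), Real.sqrt_inv,
    Real.sqrt_sq hL.le]
  congr 1
  push_cast
  rw [← div_eq_mul_inv]
  field_simp

theorem zetaDet_rectangle_lt {L : ℝ} (hL : 0 < L) (hL1 : L ≠ 1) :
    zetaDet (rectangle L) < zetaDet (rectangle 1) := by
  have hr : (L ^ 2)⁻¹ ≠ 1 := by
    rwa [Ne, inv_eq_one, pow_eq_one_iff_of_nonneg hL.le two_ne_zero]
  rw [zetaDet_rectangle hL, zetaDet_rectangle one_pos, one_pow, inv_one]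
  gcongr
  exact logDet_lt_logDet_one (by positivity) hr

lemma tendsto_zetaDet_rectangle {l : Filter ℝ} (hpos : ∀ᶠ L in l, 0 < L)
    (hl : Tendsto (fun L => logDet (L ^ 2)⁻¹) l atBot) :
    Tendsto (fun L => zetaDet (rectangle L)) l (𝓝 0) := by
  refine (Real.tendsto_exp_atBot.comp
    (tendsto_atBot_add_const_right _ (-(Real.log 2 / 2)) hl)).congr' ?_
  filter_upwards [hpos] with L hL
  exact (zetaDet_rectangle hL).symm

theorem tendsto_zetaDet_rectangle_zero :
    Tendsto (fun L => zetaDet (rectangle L)) (𝓝[>] 0) (𝓝 0) := by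
  have hsq : Tendsto (fun L : ℝ => (L ^ 2)⁻¹) (𝓝[>] 0) atTop := by
    simpa only [Function.comp_def, inv_pow] using
      (tendsto_pow_atTop two_ne_zero).comp (tendsto_inv_nhdsGT_zero (𝕜 := ℝ))
  exact tendsto_zetaDet_rectangle self_mem_nhdsWithin (tendsto_logDet_atTop.comp hsq)

theorem tendsto_zetaDet_rectangle_atTop :
    Tendsto (fun L => zetaDet (rectangle L)) atTop (𝓝 0) := by
  have hsq : Tendsto (fun L : ℝ => (L ^ 2)⁻¹) atTop (𝓝[>] 0) :=
    tendsto_inv_atTop_nhdsGT_zero.comp (tendsto_pow_atTop two_ne_zero)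
  exact tendsto_zetaDet_rectangle (eventually_gt_atTop 0) (tendsto_logDet_zero.comp hsq)

end DirichletDet

end

theorem proposition4 :
    (∀ L : ℝ, 0 < L →
      (∃! d : ℝ, DirichletDet.IsZetaDeterminant (DirichletDet.rectangle L) d) ∧
      DirichletDet.zetaDet (DirichletDet.rectangle L) =
        Real.sqrt (‖ModularForm.eta (Complex.I / (L : ℂ) ^ 2)‖ ^ 2 / (2 * L))) ∧
    (∀ L : ℝ, 0 < L → L ≠ 1 →
      DirichletDet.zetaDet (DirichletDet.rectangle L) <
        DirichletDet.zetaDet (DirichletDet.rectangle 1)) ∧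
    Filter.Tendsto (fun L : ℝ => DirichletDet.zetaDet (DirichletDet.rectangle L))
      (nhdsWithin 0 (Set.Ioi 0)) (nhds 0) ∧
    Filter.Tendsto (fun L : ℝ => DirichletDet.zetaDet (DirichletDet.rectangle L))
      Filter.atTop (nhds 0) := by
  refine ⟨fun L hL => ⟨?_, DirichletDet.zetaDet_rectangle_eq_sqrt hL⟩,
    fun L => DirichletDet.zetaDet_rectangle_lt, DirichletDet.tendsto_zetaDet_rectangle_zero,
    DirichletDet.tendsto_zetaDet_rectangle_atTop⟩
  simp only [DirichletDet.isZetaDeterminant_rectangle_iff hL, existsUnique_eq]
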